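/- Let $G$ be a group and let $g\in G$ be an element whose conjugacy class is finite. Let $\rho$ be a one-dimensional representation over $\mathbb{Q}$ of the centralizer $C_G(g)$ such that $\rho(h)\in\{-1,1\}$ for all $h\in C_G(g)$. Let $V=M(g,\rho)=\mathbb{Q}G\otimes_{\mathbb{Q}C_G(g)}\rho$ be the induced module, which is a Yetter-Drinfeld module over $\mathbb{Q}G$ with coaction $\delta(h\otimes w)=hgh^{-1}\otimes(h\otimes w)$ for $h\in G$ and $w\in\rho$. For $x\in G$ put $V_x=\{u\in V:\delta(u)=x\otimes u\}$. Let $p$ be a prime number, and let $v\in V_g\setminus\{0\}$. Let $\tau_pV=L/pL$, where $L=\mathrm{span}_{\mathbb{Z}}\{hv : h\in G\}$. (Equivalently, $L$ is the $\mathbb{Z}$-span of any basis of $V$ of the form $g_1v,\dots,g_dv$ with $g_1,\dots,g_d\in G$.) With the induced action and coaction, $\tau_pV$ is a Yetter-Drinfeld module over $\mathbb{F}_pG$. For a Yetter-Drinfeld module $U$ over a group algebra $\Bbbk G$, let $\mathfrak{B}(U)=TU/I$ be its Nichols algebra. Here the tensor algebra $TU$ has the braided comultiplication with $\Delta(u)=u\otimes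 1+1\otimes u$ for $u\in U$, and $I$ is the largest graded two-sided ideal of $TU$ that has zero components in degrees $0$ and $1$, is a Yetter-Drinfeld submodule, and is a coideal. Let $\mathfrak{B}_n(U)$ be the homogeneous component of degree $n$ of $\mathfrak{B}(U)$. Then the following hold. 1. $\dim_{\mathbb{F}_p}\mathfrak{B}_n(\tau_pV)\le\dim_{\mathbb{Q}}\mathfrak{B}_n(V)$ for all $n\ge 0$. 2. Let $m\ge 0$ be such that $\dim_{\mathbb{Q}}\mathfrak{B}_m(V)=1$ and $\dim_{\mathbb{Q}}\mathfrak{B}_n(V)=0$ for all $n>m$. If $\dim_{\mathbb{F}_p}\mathfrak{B}_m(\tau_pV)\ge 1$, then $\dim_{\mathbb{F}_p}\mathfrak{B}_n(\tau_pV)=\dim_{\mathbb{Q}}\mathfrak{B}_n(V)$ for all $n\ge 0$. -/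

import Mathlib

open scoped TensorProduct

noncomputable section

/-- A Yetter-Drinfeld module over the group algebra `kG`: a `k`-module `V` with a linear `G`-action
and a left coaction `δ : V → kG ⊗ V = G →₀ V` (the element `∑ g ⊗ v_g` is the finitely supported
function `g ↦ v_g`), such that `h V_g ⊆ V_{h g h⁻¹}`. -/
structure YetterDrinfeld (k G V : Type*) [CommRing k] [Group G] [AddCommGroup V] [Module k V] where
  /-- the action of `G` -/
  act : Representation k G V
  /-- the coaction of `kG` -/
  coact : V →ₗ[k] (G →₀ V)
  /-- the coaction is counital -/
  coact_sum : ∀ v, ((coact v).sum fun _ w => w) = v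
  /-- the coaction is coassociative: the `g`-component `v_g` satisfies `δ v_g = g ⊗ v_g` -/
  coact_coact : ∀ v g, coact (coact v g) = Finsupp.single g (coact v g)
  /-- compatibility of action and coaction: `(h v)_{h g h⁻¹} = h v_g` -/
  coact_act : ∀ h v g, coact (act h v) (h * g * h⁻¹) = act h (coact v g)

namespace YetterDrinfeld

section Nichols

variable {k G V : Type*} [CommRing k] [Group G] [AddCommGroup V] [Module k V]

/-- The homogeneous component of degree `n` of the tensor algebra. -/
abbrev tensorPart (k V : Type*) [CommRing k] [AddCommGroup V] [Module k V] (n : ℕ) :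
    Submodule k (TensorAlgebra k V) :=
  LinearMap.range (TensorAlgebra.ι k : V →ₗ[k] TensorAlgebra k V) ^ n

variable (D : YetterDrinfeld k G V)

/-- The (diagonal) action of `h ∈ G` on the tensor algebra `TV`. -/
def tensorAct (h : G) : TensorAlgebra k V →ₐ[k] TensorAlgebra k V :=
  TensorAlgebra.lift k (TensorAlgebra.ι k ∘ₗ D.act h)

/-- The (codiagonal) coaction of `kG` on the tensor algebra: the algebra map
`TV → kG ⊗ TV = (TV)[G]` that extends the coaction of `V`. -/
def tensorCoact : TensorAlgebra k V →ₐ[k] MonoidAlgebra (TensorAlgebra k V) G :=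
  TensorAlgebra.lift k
    ((Finsupp.lsum k fun g => MonoidAlgebra.lsingle (R := k) g ∘ₗ TensorAlgebra.ι k) ∘ₗ D.coact)

/-- For `v ∈ V`, left multiplication by `v ⊗ 1 + 1 ⊗ v` in the braided tensor product algebra
`TV ⊗ TV`, whose product is `(a ⊗ b)(c ⊗ d) = ∑ a (g · c) ⊗ b_g d`; that is,
`x ⊗ y ↦ v x ⊗ y + ∑_g (g · x) ⊗ v_g y`. -/
def comulMul : V →ₗ[k] Module.End k (TensorAlgebra k V ⊗[k] TensorAlgebra k V) :=
  LinearMap.rTensorHom (TensorAlgebra k V) ∘ₗ LinearMap.mul k (TensorAlgebra k V) ∘ₗ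
      TensorAlgebra.ι k +
  (Finsupp.lsum k fun g =>
    TensorProduct.mapBilinear (RingHom.id k) (TensorAlgebra k V) (TensorAlgebra k V)
        (TensorAlgebra k V) (TensorAlgebra k V) (D.tensorAct g).toLinearMap ∘ₗ
      LinearMap.mul k (TensorAlgebra k V) ∘ₗ TensorAlgebra.ι k) ∘ₗ D.coact

/-- The braided comultiplication `Δ : TV → TV ⊗ TV`, i.e. the algebra map to the braided tensor
product algebra with `Δ v = v ⊗ 1 + 1 ⊗ v` for `v ∈ V`:
`Δ (v₁ ⋯ vₙ) = (v₁ ⊗ 1 + 1 ⊗ v₁) ⋯ (vₙ ⊗ 1 + 1 ⊗ vₙ)`. -/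
def comul : TensorAlgebra k V →ₗ[k] TensorAlgebra k V ⊗[k] TensorAlgebra k V :=
  LinearMap.applyₗ (1 ⊗ₜ[k] 1) ∘ₗ (TensorAlgebra.lift k D.comulMul).toLinearMap

/-- Two-sided ideals of `TV` that are graded, have no component in degrees `0` and `1`, are
Yetter-Drinfeld submodules, and are coideals: `Δ I ⊆ I ⊗ TV + TV ⊗ I`. -/
structure IsBraidedBiideal (I : Ideal (TensorAlgebra k V)) : Prop where
  isTwoSided : I.IsTwoSided
  homogeneous : I.IsHomogeneous (tensorPart k V)
  degree_zero : ∀ x ∈ I, x ∈ tensorPart k V 0 → x = 0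
  degree_one : ∀ x ∈ I, x ∈ tensorPart k V 1 → x = 0
  act_mem : ∀ h, ∀ x ∈ I, D.tensorAct h x ∈ I
  coact_mem : ∀ g, ∀ x ∈ I, (D.tensorCoact x).coeff g ∈ I
  comul_mem : ∀ x ∈ I, D.comul x ∈
    LinearMap.range (LinearMap.rTensor (TensorAlgebra k V) (I.restrictScalars k).subtype) ⊔
    LinearMap.range (LinearMap.lTensor (TensorAlgebra k V) (I.restrictScalars k).subtype)

/-- The sum of all ideals as in `IsBraidedBiideal`: the largest one, the defining ideal of the
Nichols algebra. -/
def nicholsIdeal : Ideal (TensorAlgebra k V) :=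
  sSup {I | D.IsBraidedBiideal I}

instance nicholsIdeal_isTwoSided : D.nicholsIdeal.IsTwoSided := by
  constructor
  intro a b ha
  unfold nicholsIdeal at ha ⊢
  rw [sSup_eq_iSup'] at ha ⊢
  induction ha using Submodule.iSup_induction' with
  | mem I x hx =>
    have := I.2.isTwoSided
    exact Submodule.mem_iSup_of_mem I (I.1.mul_mem_right b hx)
  | zero => simp
  | add x y _ _ hx hy => rw [add_mul]; exact add_mem hx hy

/-- The Nichols algebra `𝔅(V)`. -/
abbrev NicholsAlgebra : Type _ := TensorAlgebra k V ⧸ D.nicholsIdeal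

/-- The homogeneous component `𝔅ₙ(V)` of degree `n`: the image of `V^{⊗ n}` in `𝔅(V)`. -/
def nicholsPart (n : ℕ) : Submodule k D.NicholsAlgebra :=
  (tensorPart k V n).map (Ideal.Quotient.mkₐ k D.nicholsIdeal).toLinearMap

end Nichols

section Induced

variable {k G W : Type*} [CommRing k] [Group G] [AddCommGroup W] [Module k W]

/-- The underlying module of `M(g, ρ)`: the induced module `kG ⊗_{k C_G(g)} W`, as realized in
Mathlib; there `IndV.mk h w` is the element `h⁻¹ ⊗ w`. -/
abbrev MCarrier (g : G) (ρ : Representation k (Subgroup.centralizer ({g} : Set G)) W) : Type _ :=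
  Representation.IndV (Subgroup.centralizer ({g} : Set G)).subtype ρ

/-- The coaction `h⁻¹ ⊗ w ↦ h⁻¹ g h ⊗ (h⁻¹ ⊗ w)` of `M(g, ρ)`. -/
def mCoact (g : G) (ρ : Representation k (Subgroup.centralizer ({g} : Set G)) W) :
    MCarrier g ρ →ₗ[k] (G →₀ MCarrier g ρ) :=
  Representation.Coinvariants.lift _
    (TensorProduct.lift
      ((Finsupp.lsum k fun h : G => LinearMap.toSpanSingleton k (W →ₗ[k] (G →₀ MCarrier g ρ))
        (Finsupp.lsingle (h⁻¹ * g * h) ∘ₗ Representation.IndV.mk _ ρ h)) ∘ₗ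
        (MonoidAlgebra.coeffLinearEquiv k).toLinearMap))
    (fun c => by
      refine TensorProduct.ext (MonoidAlgebra.lhom_ext' fun h => LinearMap.ext_ring ?_)
      refine LinearMap.ext fun w => ?_
      have hc : (c : G)⁻¹ * g * c = g := by
        rw [mul_assoc, ← Subgroup.mem_centralizer_singleton_iff.1 c.2, inv_mul_cancel_left]
      have h1 : (c * h : G)⁻¹ * g * (c * h) = h⁻¹ * g * h := by
        calc (c * h : G)⁻¹ * g * (c * h) = h⁻¹ * ((c : G)⁻¹ * g * c) * h := by group
          _ = _ := by rw [hc]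
      have h2 := Representation.Coinvariants.mk_self_apply
        (Representation.tprod ((Representation.leftRegular k G).comp
          (Subgroup.centralizer ({g} : Set G)).subtype) ρ) c (MonoidAlgebra.single h 1 ⊗ₜ w)
      simp at h2
      simp only [mul_inv_rev] at h1
      simp [h1, h2])

theorem mCoact_mk (g : G) (ρ : Representation k (Subgroup.centralizer ({g} : Set G)) W) (h : G)
    (w : W) : mCoact g ρ (Representation.IndV.mk _ ρ h w) =
      Finsupp.single (h⁻¹ * g * h) (Representation.IndV.mk _ ρ h w) := by
  simp [mCoact]

/-- The Yetter-Drinfeld module `M(g, ρ)`. -/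
def M (g : G) (ρ : Representation k (Subgroup.centralizer ({g} : Set G)) W) :
    YetterDrinfeld k G (MCarrier g ρ) where
  act := Representation.ind (Subgroup.centralizer ({g} : Set G)).subtype ρ
  coact := mCoact g ρ
  coact_sum v := by
    have : Finsupp.lsum k (fun _ : G => LinearMap.id) ∘ₗ mCoact g ρ = LinearMap.id :=
      Representation.IndV.hom_ext _ _ fun h => by
        refine LinearMap.ext fun w => ?_
        have := mCoact_mk g ρ h w
        simp only [LinearMap.comp_apply] at this ⊢
        rw [this]
        simp
    exact LinearMap.congr_fun this v
  coact_coact v x := by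
    have : mCoact g ρ ∘ₗ Finsupp.lapply x ∘ₗ mCoact g ρ =
        Finsupp.lsingle x ∘ₗ Finsupp.lapply x ∘ₗ mCoact g ρ :=
      Representation.IndV.hom_ext _ _ fun h => by
        refine LinearMap.ext fun w => ?_
        have := mCoact_mk g ρ h w
        simp only [LinearMap.comp_apply] at this ⊢
        rw [this]
        by_cases hx : h⁻¹ * g * h = x
        · simpa [hx] using this
        · simp [Finsupp.single_eq_of_ne (Ne.symm hx)]
    exact LinearMap.congr_fun this v
  coact_act h v x := by
    have : Finsupp.lapply (h * x * h⁻¹) ∘ₗ mCoact g ρ ∘ₗ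
          Representation.ind (Subgroup.centralizer ({g} : Set G)).subtype ρ h =
        Representation.ind (Subgroup.centralizer ({g} : Set G)).subtype ρ h ∘ₗ
          Finsupp.lapply x ∘ₗ mCoact g ρ :=
      Representation.IndV.hom_ext _ _ fun l => by
        refine LinearMap.ext fun w => ?_
        have h1 := mCoact_mk g ρ l w
        have h2 := mCoact_mk g ρ (l * h⁻¹) w
        have h3 := Representation.ind_mk (Subgroup.centralizer ({g} : Set G)).subtype ρ h l w
        have h4 : (l * h⁻¹)⁻¹ * g * (l * h⁻¹) = h * (l⁻¹ * g * l) * h⁻¹ := by group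
        rw [h4] at h2
        simp only [LinearMap.comp_apply] at h1 h2 h3 ⊢
        rw [h1, h3, h2]
        by_cases hx : l⁻¹ * g * l = x
        · simp [hx]
        · have hx' : h * (l⁻¹ * g * l) * h⁻¹ ≠ h * x * h⁻¹ := by simpa using hx
          simp [Finsupp.single_eq_of_ne hx'.symm, Finsupp.single_eq_of_ne (Ne.symm hx)]
    exact LinearMap.congr_fun this v

end Induced

section Reduction

variable {G V L : Type*} [Group G] [AddCommGroup V] [AddCommGroup L]

/-- For a Yetter-Drinfeld module over `ℚG` and a vector `v`, the `ℤ`-span of all `h v`, `h ∈ G`. -/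
def lattice [Module ℚ V] (D : YetterDrinfeld ℚ G V) (v : V) : Submodule ℤ V :=
  Submodule.span ℤ (Set.range fun h : G => D.act h v)

theorem act_mem_lattice [Module ℚ V] (D : YetterDrinfeld ℚ G V) (v : V) (h : G) {x : V}
    (hx : x ∈ D.lattice v) : D.act h x ∈ D.lattice v := by
  unfold lattice at hx ⊢
  induction hx using Submodule.span_induction with
  | mem x hx =>
    obtain ⟨l, rfl⟩ := hx
    exact Submodule.subset_span ⟨h * l, by simp⟩
  | zero => simp
  | add x y _ _ hx hy => rw [map_add]; exact add_mem hx hy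
  | smul n x _ hx => rw [map_zsmul]; exact Submodule.smul_mem _ n hx

theorem coact_mem_lattice [Module ℚ V] (D : YetterDrinfeld ℚ G V) {v : V} {g : G}
    (hv : D.coact v = Finsupp.single g v) (x : G) {y : V}
    (hy : y ∈ D.lattice v) : D.coact y x ∈ D.lattice v := by
  unfold lattice at hy ⊢
  induction hy using Submodule.span_induction with
  | mem y hy =>
    obtain ⟨l, rfl⟩ := hy
    have h1 := D.coact_act l v (l⁻¹ * x * l)
    have h2 : l * (l⁻¹ * x * l) * l⁻¹ = x := by group
    rw [h2, hv] at h1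
    rw [h1]
    by_cases hx : g = l⁻¹ * x * l
    · rw [← hx, Finsupp.single_eq_same]
      exact Submodule.subset_span ⟨l, rfl⟩
    · rw [Finsupp.single_eq_of_ne (Ne.symm hx), map_zero]
      exact zero_mem _
  | zero => simp
  | add y z _ _ hy hz => rw [map_add]; exact add_mem hy hz
  | smul n y _ hy => rw [map_zsmul]; exact Submodule.smul_mem _ n hy

/-- The lattice spanned by the orbit of a homogeneous vector is a Yetter-Drinfeld module over
`ℤG`, with the restricted action and coaction. -/
def integralForm [Module ℚ V] (D : YetterDrinfeld ℚ G V) {v : V} {g : G}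
    (hv : D.coact v = Finsupp.single g v) : YetterDrinfeld ℤ G (D.lattice v) where
  act :=
    { toFun h := ((D.act h).restrictScalars ℤ).restrict fun _ => D.act_mem_lattice v h
      map_one' := by ext; simp
      map_mul' h l := by
        ext x
        exact LinearMap.congr_fun (map_mul D.act h l) x }
  coact :=
    { toFun y :=
        { support := (D.coact y).support
          toFun x := ⟨D.coact y x, D.coact_mem_lattice hv x y.2⟩
          mem_support_toFun x := by simp }
      map_add' y z := by ext; simp
      map_smul' n y := by ext; simp }
  coact_sum y := by
    ext
    simpa [Finsupp.sum] using D.coact_sum y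
  coact_coact y x := by
    ext l
    have := DFunLike.congr_fun (D.coact_coact y x) l
    by_cases hx : x = l
    · subst hx; simpa using this
    · rw [Finsupp.single_eq_of_ne (Ne.symm hx)] at this ⊢
      simpa using this
  coact_act h y x := by
    ext
    exact D.coact_act h y x

/-- The reduction `L / p L` of an abelian group `L`. -/
def ModP (p : ℕ) (L : Type*) [AddCommGroup L] : Type _ :=
  L ⧸ LinearMap.range (LinearMap.lsmul ℤ L p)

instance (p : ℕ) : AddCommGroup (ModP p L) :=
  inferInstanceAs (AddCommGroup (L ⧸ LinearMap.range (LinearMap.lsmul ℤ L p)))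

/-- The quotient map `L → L / p L`. -/
def ModP.mk (p : ℕ) (L : Type*) [AddCommGroup L] : L →+ ModP p L :=
  (LinearMap.range (LinearMap.lsmul ℤ L p)).mkQ.toAddMonoidHom

instance (p : ℕ) : Module (ZMod p) (ModP p L) :=
  AddCommGroup.zmodModule (n := p) fun x => by
    obtain ⟨y, rfl⟩ := Submodule.mkQ_surjective _ x
    refine (map_nsmul (ModP.mk p L) p y).symm.trans ?_
    exact (Submodule.Quotient.mk_eq_zero _).2 ⟨y, by simp⟩

/-- A homomorphism from `L` to an elementary `p`-group factors through `L / p L`. -/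
def ModP.lift (p : ℕ) {N : Type*} [AddCommGroup N] [Module (ZMod p) N] (f : L →+ N) :
    ModP p L →ₗ[ZMod p] N :=
  AddMonoidHom.toZModLinearMap p
    ((LinearMap.range (LinearMap.lsmul ℤ L p)).liftQ f.toIntLinearMap
      (by
        rintro _ ⟨y, rfl⟩
        have : (p : ZMod p) • f y = 0 := by rw [CharP.cast_eq_zero, zero_smul]
        rw [Nat.cast_smul_eq_nsmul] at this
        change f (((p : ℕ) : ℤ) • y) = 0
        rw [map_zsmul, natCast_zsmul, this])).toAddMonoidHom

theorem ModP.mk_surjective (p : ℕ) : Function.Surjective (ModP.mk p L) :=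
  Submodule.mkQ_surjective _

theorem ModP.lift_mk (p : ℕ) {N : Type*} [AddCommGroup N] [Module (ZMod p) N] (f : L →+ N)
    (x : L) : ModP.lift p f (ModP.mk p L x) = f x :=
  rfl

/-- The reduction `L / p L` of a Yetter-Drinfeld module `L` over `ℤG`: a Yetter-Drinfeld module
over `𝔽ₚG` with the induced action and coaction. -/
def modP (p : ℕ) (E : YetterDrinfeld ℤ G L) : YetterDrinfeld (ZMod p) G (ModP p L) where
  act :=
    { toFun h := ModP.lift p ((ModP.mk p L).comp (E.act h).toAddMonoidHom)
      map_one' := by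
        ext x
        obtain ⟨y, rfl⟩ := ModP.mk_surjective p x
        simp [ModP.lift_mk]
      map_mul' h l := by
        ext x
        obtain ⟨y, rfl⟩ := ModP.mk_surjective p x
        simp [ModP.lift_mk] }
  coact := ModP.lift p
    ((Finsupp.mapRange.addMonoidHom (ModP.mk p L)).comp E.coact.toAddMonoidHom)
  coact_sum x := by
    obtain ⟨y, rfl⟩ := ModP.mk_surjective p x
    have h1 : ((Finsupp.mapRange.addMonoidHom (ModP.mk p L) (E.coact y)).sum fun _ w => w) =
        (E.coact y).sum fun _ w => ModP.mk p L w :=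
      Finsupp.sum_mapRange_index (hf := map_zero (ModP.mk p L)) fun _ => rfl
    refine h1.trans ?_
    conv_rhs => rw [← E.coact_sum y]
    simp [Finsupp.sum, map_sum]
  coact_coact x g := by
    obtain ⟨y, rfl⟩ := ModP.mk_surjective p x
    simp [ModP.lift_mk, E.coact_coact]
  coact_act h x g := by
    obtain ⟨y, rfl⟩ := ModP.mk_surjective p x
    simp [ModP.lift_mk, E.coact_act]

/-- The Yetter-Drinfeld module `τ_p V` over `𝔽ₚG`: the lattice spanned by the orbit `G v` of a
homogeneous vector `v`, modulo `p`. If `V = M(g, ρ)` for a `±1`-valued character `ρ` and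
`0 ≠ v ∈ V_g`, then any basis `g₁ v, …, g_d v` of `V` satisfies `G v ⊆ {± g₁ v, …, ± g_d v}`,
so this is the `ℤ`-span of that basis modulo `p`. -/
def tau (p : ℕ) [Module ℚ V] (D : YetterDrinfeld ℚ G V) {v : V} {g : G}
    (hv : D.coact v = Finsupp.single g v) : YetterDrinfeld (ZMod p) G (ModP p (D.lattice v)) :=
  (D.integralForm hv).modP p

end Reduction

end YetterDrinfeld

end

/-!
The Nichols algebras of `V = M(g, ρ)` and of `τ_p V` come from the same lattice, and the theorem
compares the ranks of one family of integer matrices over `ℚ` and over `𝔽ₚ`.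

**Skew derivations.** Let `D` be a Yetter-Drinfeld module with a basis of homogeneous vectors that
`G` permutes up to integers (`MonomialData`, `IsMonomial`). The component `TV → TV ⊗ V` of the
braided comultiplication gives skew derivations `∂ᵢ` of `TV`, one for each basis vector, and `∂_w`
for a word `w`. They satisfy `(id ⊗ ∂ᵢ) Δ = Δ ∂ᵢ` and `(id ⊗ ε) Δ = id`. It follows that the
common kernel `K` of all forms `ε ∂_w` is a graded ideal, a Yetter-Drinfeld submodule and a
coideal without components in degrees `0` and `1`, and that it contains every other such ideal.
Thus, over a field, the defining ideal of the Nichols algebra is `K`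
(`IsMonomial.mem_nicholsIdeal_iff`), and `dim 𝔅ₙ` is the rank of the matrix of the numbers
`ε ∂_w u` for words `w, u` of length `n` (`IsMonomial.finrank_nicholsPart`).

**Integrality.** One vector `h v` for each conjugate `h g h⁻¹` of `g`: these form bases of `V`, of
the lattice `L` and, modulo `p`, of `L / p L`, all with the same monomial data. Hence the matrices
for `V` and `τ_p V` are the images of an integer matrix (`derMatrix_eq_map_intCast`). The rank of
an integer matrix cannot increase modulo `p`; this is the first claim.

**Top degree.** For the second claim, `A = TL / K` over `ℤ` has rank one in degree `m` and
vanishes in degree `m + 1`. Let `λ` be the form on `TL` that identifies `A_m` with `ℤ`, let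
`λ(Λ) = 1`, and put `Φ(x) = (λ(x ·) ⊗ id) (Δ Λ)`. This is the usual Frobenius map of a
finite-dimensional Hopf algebra. Since `v Λ ∈ K` for `v ∈ V`, evaluating `(λ(x ·) ⊗ id) (Δ (v Λ))`
gives a recursion which shows that `Φ` maps `Tⁿ L` onto `Aₙ`
(`TopForm.tensorPart_le_map_dual_sup`). If the image of `x` in `𝔅(τ_p V)` vanishes, then so do
those of all `x y`; because the degree `m` survives modulo `p`, this means `p ∣ λ(x y)` for all
`y`, and `Φ(x)` is divisible by `p`. Thus `Φ` induces a surjection from `𝔅ₙ(τ_p V)` to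
`Aₙ / p Aₙ`, whose dimension is `dim 𝔅ₙ(V)` (`finrank_range_derMatrix_le`).
-/

noncomputable section

/-! ### Skew derivations of the tensor algebra -/

namespace YetterDrinfeld

section SkewDerivations

/-- The combinatorial data of a monomial Yetter-Drinfeld module with a basis indexed by `ι`: the
`G`-degree of each basis vector, the permutation of the indices by which `h ∈ G` acts, and the
integral scalar (in the application: a sign) that goes with it. The scalars are integers so that
the same data describes modules over `ℤ`, `ℚ` and `𝔽ₚ`. -/
structure MonomialData (G ι : Type*) [Group G] where
  /-- the `G`-degree of a basis vector -/
  deg : ι → G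
  /-- the action on the indices -/
  perm : G → ι ≃ ι
  /-- the scalars of the action -/
  sgn : G → ι → ℤ
  deg_perm : ∀ h i, deg (perm h i) = h * deg i * h⁻¹

variable {k G V ι : Type*} [CommRing k] [Group G] [AddCommGroup V] [Module k V]

/-- The basis `b` of `V` consists of homogeneous vectors that are permuted by `G` up to scalars, as
prescribed by `C`. -/
structure IsMonomial (D : YetterDrinfeld k G V) (b : Module.Basis ι k V)
    (C : MonomialData G ι) : Prop where
  coact_basis : ∀ i, D.coact (b i) = Finsupp.single (C.deg i) (b i)
  act_basis : ∀ h i, D.act h (b i) = C.sgn h i • b (C.perm h i)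

/-- A subspace of `TV` that contains `1` and is stable under left multiplication by `V` is all of
`TV`. -/
theorem mem_of_one_mem_of_ι_mul_mem (S : Submodule k (TensorAlgebra k V)) (h1 : 1 ∈ S)
    (hS : ∀ v, ∀ x ∈ S, TensorAlgebra.ι k v * x ∈ S) (x : TensorAlgebra k V) : x ∈ S := by
  have key : ∀ a : TensorAlgebra k V, ∀ y ∈ S, a * y ∈ S := by
    intro a
    induction a using TensorAlgebra.induction with
    | algebraMap r => intro y hy; rw [← Algebra.smul_def]; exact S.smul_mem r hy
    | ι v => exact hS v
    | mul a c ha hc => intro y hy; rw [mul_assoc]; exact ha _ (hc _ hy)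
    | add a c ha hc => intro y hy; rw [add_mul]; exact add_mem (ha _ hy) (hc _ hy)
  simpa using key x 1 h1

/-- Two linear maps on `TV` agree if they agree at `1` and their agreement at `x` implies their
agreement at `b i * x` for all vectors `b i` of a basis of `V`. -/
theorem linearMap_ext_of_ι_mul {N : Type*} [AddCommGroup N] [Module k N] (b : Module.Basis ι k V)
    {f f' : TensorAlgebra k V →ₗ[k] N} (h1 : f 1 = f' 1)
    (hf : ∀ i x, f x = f' x →
      f (TensorAlgebra.ι k (b i) * x) = f' (TensorAlgebra.ι k (b i) * x))
    (x : TensorAlgebra k V) : f x = f' x := by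
  refine mem_of_one_mem_of_ι_mul_mem (LinearMap.eqLocus f f') h1 (fun v x hx => ?_) x
  have h : f ∘ₗ LinearMap.mulRight k x ∘ₗ TensorAlgebra.ι k =
      f' ∘ₗ LinearMap.mulRight k x ∘ₗ TensorAlgebra.ι k := b.ext fun i => hf i x hx
  exact LinearMap.congr_fun h v

/-- The counit `TV → k`. -/
abbrev counit (k V : Type*) [CommRing k] [AddCommGroup V] [Module k V] :
    TensorAlgebra k V →ₐ[k] k :=
  TensorAlgebra.algebraMapInv

/-- The linear form on `TV` that reads off the `i`-th coordinate of the component of degree one. -/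
def degreeOneCoord (b : Module.Basis ι k V) (i : ι) : TensorAlgebra k V →ₗ[k] k :=
  TrivSqZeroExt.sndHom k k ∘ₗ
    (TensorAlgebra.lift k (TrivSqZeroExt.inrHom k k ∘ₗ b.coord i)).toLinearMap

theorem counit_ι (v : V) : counit k V (TensorAlgebra.ι k v) = 0 := by
  simp [counit, TensorAlgebra.algebraMapInv]

theorem degreeOneCoord_one (b : Module.Basis ι k V) (i : ι) : degreeOneCoord b i 1 = 0 := by
  simp [degreeOneCoord]

theorem degreeOneCoord_ι_mul (b : Module.Basis ι k V) (i : ι) (v : V) (x : TensorAlgebra k V) :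
    degreeOneCoord b i (TensorAlgebra.ι k v * x) = b.coord i v * counit k V x := by
  have h : (TrivSqZeroExt.fstHom k k k).comp
      (TensorAlgebra.lift k (TrivSqZeroExt.inrHom k k ∘ₗ b.coord i)) = counit k V := by
    ext v
    simp [counit_ι]
  have h' := AlgHom.congr_fun h x
  simp only [AlgHom.comp_apply, TrivSqZeroExt.fstHom_apply] at h'
  simp [degreeOneCoord, ← h']

variable (D : YetterDrinfeld k G V)

theorem tensorAct_ι (h : G) (v : V) :
    D.tensorAct h (TensorAlgebra.ι k v) = TensorAlgebra.ι k (D.act h v) := by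
  simp [tensorAct]

theorem tensorAct_mul_apply (g h : G) (x : TensorAlgebra k V) :
    D.tensorAct (g * h) x = D.tensorAct g (D.tensorAct h x) := by
  have : D.tensorAct (g * h) = (D.tensorAct g).comp (D.tensorAct h) := by
    ext v
    simp [tensorAct_ι]
  rw [this, AlgHom.comp_apply]

theorem tensorAct_one_apply (x : TensorAlgebra k V) : D.tensorAct 1 x = x := by
  have : D.tensorAct 1 = AlgHom.id k _ := by
    ext v
    simp [tensorAct_ι]
  rw [this, AlgHom.id_apply]

theorem counit_tensorAct (h : G) (x : TensorAlgebra k V) :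
    counit k V (D.tensorAct h x) = counit k V x := by
  have : (counit k V).comp (D.tensorAct h) = counit k V := by
    ext v
    simp [tensorAct_ι, counit_ι]
  exact AlgHom.congr_fun this x

theorem comul_one : D.comul 1 = 1 ⊗ₜ 1 := by
  simp [comul]

theorem comul_ι_mul (v : V) (x : TensorAlgebra k V) :
    D.comul (TensorAlgebra.ι k v * x) = D.comulMul v (D.comul x) := by
  simp [comul]

/-- The skew derivation `∂ᵢ` of `TV`: the coefficient of the basis vector `b i` in the component
`TV → TV ⊗ V` of the comultiplication. -/
def skewDer (b : Module.Basis ι k V) (i : ι) : TensorAlgebra k V →ₗ[k] TensorAlgebra k V :=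
  (TensorProduct.rid k (TensorAlgebra k V)).toLinearMap ∘ₗ
    (degreeOneCoord b i).lTensor (TensorAlgebra k V) ∘ₗ D.comul

variable {D} {b : Module.Basis ι k V} {C : MonomialData G ι}

theorem skewDer_one (i : ι) : D.skewDer b i 1 = 0 := by
  simp [skewDer, comul_one, degreeOneCoord_one]

theorem skewDer_algebraMap (i : ι) (r : k) : D.skewDer b i (algebraMap k _ r) = 0 := by
  rw [Algebra.algebraMap_eq_smul_one, map_smul, skewDer_one, smul_zero]

namespace IsMonomial

theorem comulMul_basis (hD : D.IsMonomial b C) (i : ι) (x y : TensorAlgebra k V) :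
    D.comulMul (b i) (x ⊗ₜ y) = (TensorAlgebra.ι k (b i) * x) ⊗ₜ y +
      D.tensorAct (C.deg i) x ⊗ₜ (TensorAlgebra.ι k (b i) * y) := by
  simp [comulMul, hD.coact_basis]

theorem tensorAct_ι_mul (hD : D.IsMonomial b C) (h : G) (i : ι) (x : TensorAlgebra k V) :
    D.tensorAct h (TensorAlgebra.ι k (b i) * x) =
      C.sgn h i • (TensorAlgebra.ι k (b (C.perm h i)) * D.tensorAct h x) := by
  rw [map_mul, tensorAct_ι, hD.act_basis, map_zsmul, smul_mul_assoc]

/-- `(id ⊗ ε) ∘ Δ = id` -/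
theorem rid_counit_comul (hD : D.IsMonomial b C) (x : TensorAlgebra k V) :
    TensorProduct.rid k (TensorAlgebra k V)
      ((counit k V).toLinearMap.lTensor (TensorAlgebra k V) (D.comul x)) = x := by
  let F : TensorAlgebra k V ⊗[k] TensorAlgebra k V →ₗ[k] TensorAlgebra k V :=
    (TensorProduct.rid k (TensorAlgebra k V)).toLinearMap ∘ₗ
      (counit k V).toLinearMap.lTensor (TensorAlgebra k V)
  have hF : ∀ i, F ∘ₗ D.comulMul (b i) = LinearMap.mulLeft k (TensorAlgebra.ι k (b i)) ∘ₗ F := by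
    intro i
    refine TensorProduct.ext' fun x y => ?_
    simp [F, hD.comulMul_basis, counit_ι]
  refine linearMap_ext_of_ι_mul b (f := F ∘ₗ D.comul) (f' := LinearMap.id) ?_ ?_ x
  · simp [F, comul_one]
  · intro i x hx
    have := LinearMap.congr_fun (hF i) (D.comul x)
    simp only [LinearMap.comp_apply, LinearMap.id_apply] at hx this ⊢
    rw [comul_ι_mul, this, hx, LinearMap.mulLeft_apply]

theorem comul_tensorAct (hD : D.IsMonomial b C) (h : G) (x : TensorAlgebra k V) :
    D.comul (D.tensorAct h x) =
      TensorProduct.map (D.tensorAct h).toLinearMap (D.tensorAct h).toLinearMap (D.comul x) := by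
  refine linearMap_ext_of_ι_mul b (f := D.comul ∘ₗ (D.tensorAct h).toLinearMap)
    (f' := TensorProduct.map (D.tensorAct h).toLinearMap (D.tensorAct h).toLinearMap ∘ₗ
      D.comul) ?_ ?_ x
  · simp [comul_one]
  · intro i x hx
    have key : TensorProduct.map (D.tensorAct h).toLinearMap (D.tensorAct h).toLinearMap ∘ₗ
        D.comulMul (b i) = C.sgn h i • (D.comulMul (b (C.perm h i)) ∘ₗ
          TensorProduct.map (D.tensorAct h).toLinearMap (D.tensorAct h).toLinearMap) := by
      refine TensorProduct.ext' fun y z => ?_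
      have h1 : C.deg (C.perm h i) * h = h * C.deg i := by rw [C.deg_perm]; group
      simp only [LinearMap.comp_apply, LinearMap.smul_apply, hD.comulMul_basis, map_add,
        TensorProduct.map_tmul, AlgHom.toLinearMap_apply, hD.tensorAct_ι_mul, smul_add]
      rw [← tensorAct_mul_apply, ← tensorAct_mul_apply, h1]
      simp only [TensorProduct.tmul_smul, TensorProduct.smul_tmul']
    have := LinearMap.congr_fun key (D.comul x)
    simp only [LinearMap.comp_apply, LinearMap.smul_apply, AlgHom.toLinearMap_apply] at hx this ⊢
    rw [hD.tensorAct_ι_mul, map_zsmul, comul_ι_mul, comul_ι_mul, hx, this]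

variable [DecidableEq ι]

theorem skewDer_basis_mul (hD : D.IsMonomial b C) (i j : ι) (x : TensorAlgebra k V) :
    D.skewDer b i (TensorAlgebra.ι k (b j) * x) = TensorAlgebra.ι k (b j) * D.skewDer b i x +
      if j = i then D.tensorAct (C.deg i) x else 0 := by
  -- `(id ⊗ ξᵢ)(vⱼ z) = vⱼ (id ⊗ ξᵢ)(z) + δᵢⱼ gᵢ (id ⊗ ε)(z)` for the coordinate `ξᵢ` of degree one
  let F : TensorAlgebra k V ⊗[k] TensorAlgebra k V →ₗ[k] TensorAlgebra k V :=
    (TensorProduct.rid k (TensorAlgebra k V)).toLinearMap ∘ₗ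
      (degreeOneCoord b i).lTensor (TensorAlgebra k V)
  let E : TensorAlgebra k V ⊗[k] TensorAlgebra k V →ₗ[k] TensorAlgebra k V :=
    (TensorProduct.rid k (TensorAlgebra k V)).toLinearMap ∘ₗ
      (counit k V).toLinearMap.lTensor (TensorAlgebra k V)
  have hF : F ∘ₗ D.comulMul (b j) = LinearMap.mulLeft k (TensorAlgebra.ι k (b j)) ∘ₗ F +
      if j = i then (D.tensorAct (C.deg i)).toLinearMap ∘ₗ E else 0 := by
    refine TensorProduct.ext' fun x y => ?_
    by_cases h : j = i
    · subst h
      simp [F, E, hD.comulMul_basis, degreeOneCoord_ι_mul]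
    · simp [F, hD.comulMul_basis, degreeOneCoord_ι_mul, h]
  have h1 := LinearMap.congr_fun hF (D.comul x)
  have h2 : E (D.comul x) = x := hD.rid_counit_comul x
  have h3 : D.skewDer b i (TensorAlgebra.ι k (b j) * x) = F (D.comulMul (b j) (D.comul x)) := by
    rw [← comul_ι_mul]; rfl
  rw [h3]
  refine h1.trans ?_
  by_cases h : j = i
  · simp only [h, if_true, LinearMap.add_apply, LinearMap.comp_apply, h2]
    rfl
  · simp only [h, if_false, LinearMap.add_apply, LinearMap.comp_apply, LinearMap.zero_apply]
    rfl

/-- The skew Leibniz rule. -/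
theorem skewDer_mul (hD : D.IsMonomial b C) (i : ι) (x y : TensorAlgebra k V) :
    D.skewDer b i (x * y) =
      x * D.skewDer b i y + D.skewDer b i x * D.tensorAct (C.deg i) y := by
  refine linearMap_ext_of_ι_mul b (f := D.skewDer b i ∘ₗ LinearMap.mulRight k y)
    (f' := LinearMap.mulRight k (D.skewDer b i y) +
      LinearMap.mulRight k (D.tensorAct (C.deg i) y) ∘ₗ D.skewDer b i) ?_ ?_ x
  · simp [skewDer_one]
  · intro j x hx
    simp only [LinearMap.comp_apply, LinearMap.add_apply, LinearMap.mulRight_apply] at hx ⊢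
    rw [mul_assoc, hD.skewDer_basis_mul, hD.skewDer_basis_mul, hx]
    split_ifs with h
    · simp only [map_mul, mul_add, add_mul, mul_assoc]
      abel
    · simp only [mul_add, mul_assoc, add_zero]

theorem skewDer_ι_mul (hD : D.IsMonomial b C) (i : ι) (v : V) (x : TensorAlgebra k V) :
    D.skewDer b i (TensorAlgebra.ι k v * x) =
      TensorAlgebra.ι k v * D.skewDer b i x + b.coord i v • D.tensorAct (C.deg i) x := by
  have h : D.skewDer b i ∘ₗ LinearMap.mulRight k x ∘ₗ TensorAlgebra.ι k =
      LinearMap.mulRight k (D.skewDer b i x) ∘ₗ TensorAlgebra.ι k +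
        (b.coord i).smulRight (D.tensorAct (C.deg i) x) := by
    refine b.ext fun j => ?_
    simp [hD.skewDer_basis_mul, Finsupp.single_apply]
  exact LinearMap.congr_fun h v

theorem skewDer_tensorAct (hD : D.IsMonomial b C) (h : G) (i : ι) (x : TensorAlgebra k V) :
    D.skewDer b (C.perm h i) (D.tensorAct h x) =
      C.sgn h i • D.tensorAct h (D.skewDer b i x) := by
  refine linearMap_ext_of_ι_mul b
    (f := D.skewDer b (C.perm h i) ∘ₗ (D.tensorAct h).toLinearMap)
    (f' := C.sgn h i • ((D.tensorAct h).toLinearMap ∘ₗ D.skewDer b i)) ?_ ?_ x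
  · simp [skewDer_one]
  · intro j x hx
    simp only [LinearMap.comp_apply, LinearMap.smul_apply, AlgHom.toLinearMap_apply] at hx ⊢
    rw [hD.tensorAct_ι_mul, map_zsmul, hD.skewDer_basis_mul, hx, hD.skewDer_basis_mul, map_add,
      hD.tensorAct_ι_mul, smul_add, smul_add, mul_smul_comm, smul_comm (C.sgn h i)]
    congr 1
    by_cases hij : j = i
    · subst hij
      have h1 : C.deg (C.perm h j) * h = h * C.deg j := by rw [C.deg_perm]; group
      simp only [if_true]
      rw [← tensorAct_mul_apply, h1, tensorAct_mul_apply]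
    · have : C.perm h j ≠ C.perm h i := fun h' => hij ((C.perm h).injective h')
      simp [hij, this]

/-- `(id ⊗ ∂ᵢ) ∘ Δ = Δ ∘ ∂ᵢ` -/
theorem lTensor_skewDer_comul (hD : D.IsMonomial b C) (i : ι) (x : TensorAlgebra k V) :
    (D.skewDer b i).lTensor (TensorAlgebra k V) (D.comul x) = D.comul (D.skewDer b i x) := by
  refine linearMap_ext_of_ι_mul b
    (f := (D.skewDer b i).lTensor (TensorAlgebra k V) ∘ₗ D.comul)
    (f' := D.comul ∘ₗ D.skewDer b i) ?_ ?_ x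
  · simp [comul_one, skewDer_one]
  · intro j x hx
    have key : (D.skewDer b i).lTensor (TensorAlgebra k V) ∘ₗ D.comulMul (b j) =
        D.comulMul (b j) ∘ₗ (D.skewDer b i).lTensor (TensorAlgebra k V) +
          if j = i then TensorProduct.map (D.tensorAct (C.deg i)).toLinearMap
            (D.tensorAct (C.deg i)).toLinearMap else 0 := by
      refine TensorProduct.ext' fun y z => ?_
      by_cases h : j = i
      · subst h
        simp [hD.comulMul_basis, hD.skewDer_basis_mul, TensorProduct.tmul_add, add_assoc]
      · simp [hD.comulMul_basis, hD.skewDer_basis_mul, h]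
    have := LinearMap.congr_fun key (D.comul x)
    simp only [LinearMap.comp_apply] at hx this ⊢
    rw [comul_ι_mul, this, hD.skewDer_basis_mul, LinearMap.add_apply, LinearMap.comp_apply, hx,
      map_add, comul_ι_mul]
    congr 1
    split_ifs with h
    · exact (hD.comul_tensorAct _ x).symm
    · simp

end IsMonomial

theorem tensorPart_zero : tensorPart k V 0 = 1 := pow_zero _

theorem tensorPart_succ (n : ℕ) :
    tensorPart k V (n + 1) = LinearMap.range (TensorAlgebra.ι k) * tensorPart k V n :=
  pow_succ' _ _

/-- Induction along `V ⊗ Tⁿ V = Tⁿ⁺¹ V`. -/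
theorem tensorPart_succ_induction {n : ℕ} {S : Submodule k (TensorAlgebra k V)}
    (hS : ∀ v, ∀ x ∈ tensorPart k V n, TensorAlgebra.ι k v * x ∈ S) :
    tensorPart k V (n + 1) ≤ S := by
  rw [tensorPart_succ, Submodule.mul_le]
  rintro _ ⟨v, rfl⟩ x hx
  exact hS v x hx

theorem ι_mul_mem_tensorPart {n : ℕ} (v : V) {x : TensorAlgebra k V}
    (hx : x ∈ tensorPart k V n) : TensorAlgebra.ι k v * x ∈ tensorPart k V (n + 1) := by
  rw [tensorPart_succ]
  exact Submodule.mul_mem_mul ⟨v, rfl⟩ hx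

theorem mul_ι_mem_tensorPart {n : ℕ} (v : V) {x : TensorAlgebra k V}
    (hx : x ∈ tensorPart k V n) : x * TensorAlgebra.ι k v ∈ tensorPart k V (n + 1) := by
  rw [tensorPart, pow_succ]
  exact Submodule.mul_mem_mul hx ⟨v, rfl⟩

variable (D) in
theorem tensorAct_mem_tensorPart (h : G) {n : ℕ} {x : TensorAlgebra k V}
    (hx : x ∈ tensorPart k V n) : D.tensorAct h x ∈ tensorPart k V n := by
  induction n generalizing x with
  | zero =>
    obtain ⟨r, rfl⟩ := Submodule.mem_one.1 (tensorPart_zero (k := k) (V := V) ▸ hx)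
    simp
  | succ n ih =>
    refine tensorPart_succ_induction
      (S := (tensorPart k V (n + 1)).comap (D.tensorAct h).toLinearMap) (fun v y hy => ?_) hx
    rw [Submodule.mem_comap, AlgHom.toLinearMap_apply, map_mul, tensorAct_ι]
    exact ι_mul_mem_tensorPart _ (ih hy)

theorem skewDer_tensorPart_zero (i : ι) {x : TensorAlgebra k V} (hx : x ∈ tensorPart k V 0) :
    D.skewDer b i x = 0 := by
  obtain ⟨r, rfl⟩ := Submodule.mem_one.1 (tensorPart_zero (k := k) (V := V) ▸ hx)
  exact skewDer_algebraMap i r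

theorem counit_tensorPart_succ {n : ℕ} {x : TensorAlgebra k V}
    (hx : x ∈ tensorPart k V (n + 1)) : counit k V x = 0 := by
  refine tensorPart_succ_induction (S := LinearMap.ker (counit k V).toLinearMap)
    (fun v y _ => ?_) hx
  rw [LinearMap.mem_ker, AlgHom.toLinearMap_apply, map_mul, counit_ι, zero_mul]

variable [DecidableEq ι]

theorem IsMonomial.skewDer_mem_tensorPart (hD : D.IsMonomial b C) (i : ι) {n : ℕ}
    {x : TensorAlgebra k V} (hx : x ∈ tensorPart k V (n + 1)) :
    D.skewDer b i x ∈ tensorPart k V n := by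
  induction n generalizing x with
  | zero =>
    refine tensorPart_succ_induction (S := (tensorPart k V 0).comap (D.skewDer b i))
      (fun v y hy => ?_) hx
    rw [Submodule.mem_comap, hD.skewDer_ι_mul, skewDer_tensorPart_zero i hy, mul_zero, zero_add]
    exact Submodule.smul_mem _ _ (D.tensorAct_mem_tensorPart _ hy)
  | succ n ih =>
    refine tensorPart_succ_induction (S := (tensorPart k V (n + 1)).comap (D.skewDer b i))
      (fun v y hy => ?_) hx
    rw [Submodule.mem_comap, hD.skewDer_ι_mul]
    exact add_mem (ι_mul_mem_tensorPart _ (ih hy))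
      (Submodule.smul_mem _ _ (D.tensorAct_mem_tensorPart _ hy))

end SkewDerivations
end YetterDrinfeld

/-! ### The defining ideal of the Nichols algebra -/

namespace YetterDrinfeld

section NicholsKernel

variable {k G V ι : Type*} [CommRing k] [Group G] [AddCommGroup V] [Module k V]
variable (D : YetterDrinfeld k G V) (b : Module.Basis ι k V)

/-- The composition of skew derivations along a word; the first letter acts first. -/
def iterSkewDer : List ι → TensorAlgebra k V →ₗ[k] TensorAlgebra k V
  | [] => LinearMap.id
  | i :: w => iterSkewDer w ∘ₗ D.skewDer b i

/-- The linear form `ε ∘ ∂_w` on `TV` for a word `w`. -/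
def derForm (w : List ι) : TensorAlgebra k V →ₗ[k] k :=
  (counit k V).toLinearMap ∘ₗ D.iterSkewDer b w

@[simp]
theorem derForm_nil (x : TensorAlgebra k V) : D.derForm b [] x = counit k V x := rfl

@[simp]
theorem derForm_cons (i : ι) (w : List ι) (x : TensorAlgebra k V) :
    D.derForm b (i :: w) x = D.derForm b w (D.skewDer b i x) := rfl

/-- The common kernel of all forms `ε ∘ ∂_w`. Over a field this is the defining ideal of the
Nichols algebra, see `IsMonomial.mem_nicholsIdeal_iff`. -/
def derKernel : Submodule k (TensorAlgebra k V) := ⨅ w, LinearMap.ker (D.derForm b w)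

variable {D b} {C : MonomialData G ι}

theorem mem_derKernel {x : TensorAlgebra k V} :
    x ∈ D.derKernel b ↔ ∀ w, D.derForm b w x = 0 := by
  simp [derKernel]

theorem skewDer_mem_derKernel (i : ι) {x : TensorAlgebra k V} (hx : x ∈ D.derKernel b) :
    D.skewDer b i x ∈ D.derKernel b :=
  mem_derKernel.2 fun w => mem_derKernel.1 hx (i :: w)

theorem iterSkewDer_mem_derKernel (w : List ι) {x : TensorAlgebra k V}
    (hx : x ∈ D.derKernel b) : D.iterSkewDer b w x ∈ D.derKernel b := by
  induction w generalizing x with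
  | nil => exact hx
  | cons i w ih => exact ih (skewDer_mem_derKernel i hx)

/-- A linear map on `TV` that vanishes in all degrees but `n` only sees the component of
degree `n`. -/
theorem map_eq_map_proj {N : Type*} [AddCommGroup N] [Module k N] (f : TensorAlgebra k V →ₗ[k] N)
    {n : ℕ} (hf : ∀ l, l ≠ n → ∀ y ∈ tensorPart k V l, f y = 0) (x : TensorAlgebra k V) :
    f x = f (DirectSum.decompose (tensorPart k V) x n : TensorAlgebra k V) := by
  classical
  conv_lhs => rw [← DirectSum.sum_support_decompose (tensorPart k V) x, map_sum]
  refine Finset.sum_eq_single n (fun l _ hl => hf l hl _ (SetLike.coe_mem _)) (fun hn => ?_)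
  rw [DFinsupp.notMem_support_iff.1 hn]
  simp

theorem degreeOneCoord_eq_zero_of_ne (i : ι) {l : ℕ} (hl : l ≠ 1) {x : TensorAlgebra k V}
    (hx : x ∈ tensorPart k V l) : degreeOneCoord b i x = 0 := by
  cases l with
  | zero =>
    obtain ⟨r, rfl⟩ := Submodule.mem_one.1 (tensorPart_zero (k := k) (V := V) ▸ hx)
    rw [Algebra.algebraMap_eq_smul_one, map_smul, degreeOneCoord_one, smul_zero]
  | succ l =>
    obtain ⟨l, rfl⟩ := Nat.exists_eq_succ_of_ne_zero (fun h => hl (by rw [h]) : l ≠ 0)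
    refine tensorPart_succ_induction (S := LinearMap.ker (degreeOneCoord b i))
      (fun v y hy => ?_) hx
    rw [LinearMap.mem_ker, degreeOneCoord_ι_mul, counit_tensorPart_succ hy, mul_zero]

namespace IsMonomial

section

variable (D) in
/-- The component `x ↦ x_g` of the coaction of `TV`. -/
def coactComponent (g : G) : TensorAlgebra k V →ₗ[k] TensorAlgebra k V where
  toFun x := (D.tensorCoact x).coeff g
  map_add' x y := by simp
  map_smul' r x := by simp

theorem coactComponent_one (g : G) [Decidable (g = 1)] :
    coactComponent D g 1 = if g = 1 then 1 else 0 := by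
  change (D.tensorCoact 1).coeff g = _
  rw [map_one, MonoidAlgebra.one_def, MonoidAlgebra.coeff_single]
  split_ifs with h
  · rw [h, Finsupp.single_eq_same]
  · rw [Finsupp.single_eq_of_ne h]

theorem coactComponent_ι_mul (hD : D.IsMonomial b C) (g : G) (i : ι) (x : TensorAlgebra k V) :
    coactComponent D g (TensorAlgebra.ι k (b i) * x) =
      TensorAlgebra.ι k (b i) * coactComponent D ((C.deg i)⁻¹ * g) x := by
  change (D.tensorCoact _).coeff g = _ * (D.tensorCoact x).coeff _
  rw [map_mul]
  simp [tensorCoact, hD.coact_basis]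

theorem coactComponent_tensorAct (hD : D.IsMonomial b C) (g h : G) (x : TensorAlgebra k V) :
    coactComponent D (h * g * h⁻¹) (D.tensorAct h x) = D.tensorAct h (coactComponent D g x) := by
  classical
  have key := fun (x : TensorAlgebra k V) => linearMap_ext_of_ι_mul b
    (f := LinearMap.pi fun g => coactComponent D (h * g * h⁻¹) ∘ₗ (D.tensorAct h).toLinearMap)
    (f' := LinearMap.pi fun g => (D.tensorAct h).toLinearMap ∘ₗ coactComponent D g) ?_ ?_ x
  · exact congrFun (key x) g
  · ext g
    have : h * g * h⁻¹ = 1 ↔ g = 1 := by simp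
    simp only [LinearMap.pi_apply, LinearMap.comp_apply, AlgHom.toLinearMap_apply, map_one,
      coactComponent_one, this]
    split_ifs <;> simp
  · intro i x hx
    ext g
    have hx' := congrFun hx ((C.deg i)⁻¹ * g)
    have hg : (C.deg (C.perm h i))⁻¹ * (h * g * h⁻¹) = h * ((C.deg i)⁻¹ * g) * h⁻¹ := by
      rw [C.deg_perm]; group
    simp only [LinearMap.pi_apply, LinearMap.comp_apply, AlgHom.toLinearMap_apply] at hx' ⊢
    rw [hD.tensorAct_ι_mul, map_zsmul, coactComponent_ι_mul hD, coactComponent_ι_mul hD,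
      hD.tensorAct_ι_mul, hg, hx']

theorem counit_coactComponent (hD : D.IsMonomial b C) (g : G) [Decidable (g = 1)]
    (x : TensorAlgebra k V) :
    counit k V (coactComponent D g x) = if g = 1 then counit k V x else 0 := by
  refine linearMap_ext_of_ι_mul b (f := (counit k V).toLinearMap ∘ₗ coactComponent D g)
    (f' := if g = 1 then (counit k V).toLinearMap else 0) ?_ ?_ x |>.trans ?_
  · rw [LinearMap.comp_apply, coactComponent_one]
    split_ifs <;> simp
  · intro i x _
    rw [LinearMap.comp_apply, coactComponent_ι_mul hD]
    split_ifs <;> simp [counit_ι]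
  · split_ifs <;> rfl

theorem skewDer_coactComponent [DecidableEq ι] (hD : D.IsMonomial b C) (g : G) (i : ι)
    (x : TensorAlgebra k V) :
    D.skewDer b i (coactComponent D g x) =
      coactComponent D (g * (C.deg i)⁻¹) (D.skewDer b i x) := by
  classical
  have key := fun (x : TensorAlgebra k V) => linearMap_ext_of_ι_mul b
    (f := LinearMap.pi fun g => D.skewDer b i ∘ₗ coactComponent D g)
    (f' := LinearMap.pi fun g => coactComponent D (g * (C.deg i)⁻¹) ∘ₗ D.skewDer b i) ?_ ?_ x
  · exact congrFun (key x) g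
  · ext g
    simp only [LinearMap.pi_apply, LinearMap.comp_apply, coactComponent_one, skewDer_one, map_zero]
    split_ifs <;> simp [skewDer_one]
  · intro j x hx
    ext g
    have hx' := congrFun hx ((C.deg j)⁻¹ * g)
    simp only [LinearMap.pi_apply, LinearMap.comp_apply] at hx' ⊢
    rw [coactComponent_ι_mul hD, hD.skewDer_basis_mul, hD.skewDer_basis_mul, map_add,
      coactComponent_ι_mul hD, hx', mul_assoc]
    congr 1
    split_ifs with h
    · subst h
      rw [← coactComponent_tensorAct hD]
      congr 2
      group
    · simp

theorem coactComponent_mem_derKernel [DecidableEq ι] (hD : D.IsMonomial b C) (g : G)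
    {x : TensorAlgebra k V} (hx : x ∈ D.derKernel b) :
    coactComponent D g x ∈ D.derKernel b := by
  classical
  rw [mem_derKernel]
  intro w
  induction w generalizing g x with
  | nil =>
    have : counit k V x = 0 := mem_derKernel.1 hx []
    simp [counit_coactComponent hD, this]
  | cons i w ih =>
    rw [derForm_cons, skewDer_coactComponent hD, ih _ (skewDer_mem_derKernel i hx)]

variable [DecidableEq ι] (hD : D.IsMonomial b C)

include hD

/-- `G` permutes the forms `ε ∘ ∂_w` of a given length up to scalars. -/
theorem derForm_tensorAct_eq_zero (h : G) (w : List ι) {x : TensorAlgebra k V}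
    (hx : ∀ u : List ι, u.length = w.length → D.derForm b u x = 0) :
    D.derForm b w (D.tensorAct h x) = 0 := by
  induction w generalizing x with
  | nil => simpa [counit_tensorAct] using hx [] rfl
  | cons i w ih =>
    obtain ⟨i, rfl⟩ := (C.perm h).surjective i
    rw [derForm_cons, hD.skewDer_tensorAct, map_zsmul, ih, smul_zero]
    intro u hu
    exact hx (i :: u) (by simp [hu])

theorem tensorAct_mem_derKernel (h : G) {x : TensorAlgebra k V} (hx : x ∈ D.derKernel b) :
    D.tensorAct h x ∈ D.derKernel b :=
  mem_derKernel.2 fun w => hD.derForm_tensorAct_eq_zero h w fun u _ => mem_derKernel.1 hx u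

theorem ι_mul_mem_derKernel (v : V) {x : TensorAlgebra k V} (hx : x ∈ D.derKernel b) :
    TensorAlgebra.ι k v * x ∈ D.derKernel b := by
  rw [mem_derKernel]
  intro w
  induction w generalizing x with
  | nil => simp [counit_ι]
  | cons i w ih =>
    rw [derForm_cons, hD.skewDer_ι_mul, map_add, map_smul, ih (skewDer_mem_derKernel i hx),
      mem_derKernel.1 (hD.tensorAct_mem_derKernel _ hx), smul_zero, add_zero]

theorem mul_mem_derKernel_left (a : TensorAlgebra k V) {x : TensorAlgebra k V}
    (hx : x ∈ D.derKernel b) : a * x ∈ D.derKernel b := by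
  refine mem_of_one_mem_of_ι_mul_mem ((D.derKernel b).comap (LinearMap.mulRight k x)) ?_ ?_ a
  · simpa using hx
  · intro v y hy
    simp only [Submodule.mem_comap, LinearMap.mulRight_apply, mul_assoc] at hy ⊢
    exact hD.ι_mul_mem_derKernel v hy

theorem mul_mem_derKernel_right (a : TensorAlgebra k V) {x : TensorAlgebra k V}
    (hx : x ∈ D.derKernel b) : x * a ∈ D.derKernel b := by
  rw [mem_derKernel]
  intro w
  induction w generalizing x a with
  | nil =>
    have : counit k V x = 0 := mem_derKernel.1 hx []
    simp [this]
  | cons i w ih =>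
    rw [derForm_cons, hD.skewDer_mul, map_add, ih _ hx, ih _ (skewDer_mem_derKernel i hx),
      add_zero]

/-- `ε ∘ ∂_w` lives in degree `|w|`. -/
theorem derForm_eq_zero_of_length_ne {n : ℕ} {w : List ι} (hw : w.length ≠ n)
    {x : TensorAlgebra k V} (hx : x ∈ tensorPart k V n) : D.derForm b w x = 0 := by
  induction w generalizing n x with
  | nil =>
    obtain ⟨n, rfl⟩ := Nat.exists_eq_succ_of_ne_zero (Ne.symm hw)
    exact counit_tensorPart_succ hx
  | cons i w ih =>
    cases n with
    | zero => rw [derForm_cons, skewDer_tensorPart_zero i hx, map_zero]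
    | succ n => exact ih (by simpa using hw) (hD.skewDer_mem_tensorPart i hx)

theorem proj_mem_derKernel (n : ℕ) {x : TensorAlgebra k V} (hx : x ∈ D.derKernel b) :
    (DirectSum.decompose (tensorPart k V) x n : TensorAlgebra k V) ∈ D.derKernel b := by
  rw [mem_derKernel]
  intro w
  by_cases hw : w.length = n
  · rw [← mem_derKernel.1 hx w, eq_comm]
    exact map_eq_map_proj _ (fun l hl y hy => hD.derForm_eq_zero_of_length_ne (by omega) hy) x
  · exact hD.derForm_eq_zero_of_length_ne hw (SetLike.coe_mem _)

/-- `(id ⊗ ε ∂_w) ∘ Δ = ∂_w` -/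
theorem rid_derForm_comul (w : List ι) (x : TensorAlgebra k V) :
    TensorProduct.rid k (TensorAlgebra k V)
      ((D.derForm b w).lTensor (TensorAlgebra k V) (D.comul x)) = D.iterSkewDer b w x := by
  induction w generalizing x with
  | nil => exact hD.rid_counit_comul x
  | cons i w ih =>
    have : D.derForm b (i :: w) = D.derForm b w ∘ₗ D.skewDer b i := rfl
    rw [this, LinearMap.lTensor_comp, LinearMap.comp_apply, hD.lTensor_skewDer_comul, ih]
    rfl

end

end IsMonomial

end NicholsKernel

section NicholsIdeal

variable {k G V ι : Type*} [Field k] [Group G] [AddCommGroup V] [Module k V]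
variable {D : YetterDrinfeld k G V} {b : Module.Basis ι k V} {C : MonomialData G ι}

/-- Over a field, an element `z` of `TV ⊗ TV` that is mapped to the kernel `K` of the forms
`ε ∘ ∂_w` by all maps `id ⊗ ε ∂_w` lies in `K ⊗ TV + TV ⊗ K`: expand the image of `z` in
`TV / K ⊗ TV` along a basis of `TV / K`. -/
theorem mem_range_sup_range_of_rid_derForm_mem (z : TensorAlgebra k V ⊗[k] TensorAlgebra k V)
    (hz : ∀ w, TensorProduct.rid k (TensorAlgebra k V)
      ((D.derForm b w).lTensor (TensorAlgebra k V) z) ∈ D.derKernel b) :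
    z ∈ LinearMap.range (LinearMap.rTensor (TensorAlgebra k V) (D.derKernel b).subtype) ⊔
      LinearMap.range (LinearMap.lTensor (TensorAlgebra k V) (D.derKernel b).subtype) := by
  classical
  set K := D.derKernel b
  let e := Module.Free.chooseBasis k (TensorAlgebra k V ⧸ K)
  have hcoord : ∀ β, (TensorProduct.equivFinsuppOfBasisLeft e
      (K.mkQ.rTensor (TensorAlgebra k V) z) : _ →₀ TensorAlgebra k V) β ∈ K := by
    intro β
    refine mem_derKernel.2 fun w => ?_
    have key : D.derForm b w ∘ₗ Finsupp.lapply β ∘ₗ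
        (TensorProduct.equivFinsuppOfBasisLeft (N := TensorAlgebra k V) e).toLinearMap ∘ₗ
          K.mkQ.rTensor (TensorAlgebra k V) =
        e.coord β ∘ₗ K.mkQ ∘ₗ (TensorProduct.rid k (TensorAlgebra k V)).toLinearMap ∘ₗ
          (D.derForm b w).lTensor (TensorAlgebra k V) := by
      refine TensorProduct.ext' fun x y => ?_
      simp [mul_comm]
    have h := LinearMap.congr_fun key z
    simp only [LinearMap.comp_apply, LinearEquiv.coe_coe] at h
    rw [Finsupp.lapply_apply] at h
    rw [h, Submodule.mkQ_apply, (Submodule.Quotient.mk_eq_zero K).2 (hz w), map_zero]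
  have hq : TensorProduct.map K.mkQ K.mkQ z = 0 := by
    have h1 : TensorProduct.map K.mkQ K.mkQ z =
        K.mkQ.lTensor _ (K.mkQ.rTensor (TensorAlgebra k V) z) := by
      rw [← LinearMap.comp_apply, LinearMap.lTensor_comp_rTensor]
    rw [h1, ← (TensorProduct.equivFinsuppOfBasisLeft e).symm_apply_apply
      (K.mkQ.rTensor (TensorAlgebra k V) z), TensorProduct.equivFinsuppOfBasisLeft_symm_apply,
      Finsupp.sum, map_sum]
    refine Finset.sum_eq_zero fun β _ => ?_
    rw [LinearMap.lTensor_tmul, Submodule.mkQ_apply,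
      (Submodule.Quotient.mk_eq_zero K).2 (hcoord β), TensorProduct.tmul_zero]
  rw [sup_comm, ← TensorProduct.map_ker (LinearMap.exact_subtype_mkQ K) K.mkQ_surjective
    (LinearMap.exact_subtype_mkQ K) K.mkQ_surjective]
  exact hq

/-- A graded coideal without component in degree one is stable under the skew derivations. -/
theorem IsBraidedBiideal.skewDer_mem {I : Ideal (TensorAlgebra k V)}
    (hI : D.IsBraidedBiideal I) (i : ι) {x : TensorAlgebra k V} (hx : x ∈ I) :
    D.skewDer b i x ∈ I := by
  have hcoord : ∀ y ∈ I, degreeOneCoord b i y = 0 := fun y hy => by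
    rw [map_eq_map_proj _ (fun l hl z hz => degreeOneCoord_eq_zero_of_ne i hl hz) y,
      hI.degree_one _ (hI.homogeneous 1 hy) (SetLike.coe_mem _), map_zero]
  have key : LinearMap.range (LinearMap.rTensor (TensorAlgebra k V) (I.restrictScalars k).subtype) ⊔
      LinearMap.range (LinearMap.lTensor (TensorAlgebra k V) (I.restrictScalars k).subtype) ≤
      (I.restrictScalars k).comap ((TensorProduct.rid k (TensorAlgebra k V)).toLinearMap ∘ₗ
        (degreeOneCoord b i).lTensor (TensorAlgebra k V)) := by
    refine sup_le ?_ ?_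
    · rintro _ ⟨z, rfl⟩
      induction z with
      | zero => simp
      | add y z hy hz => rw [map_add]; exact add_mem hy hz
      | tmul y z =>
        simp only [LinearMap.rTensor_tmul, Submodule.mem_comap, LinearMap.comp_apply,
          LinearMap.lTensor_tmul, LinearEquiv.coe_coe, TensorProduct.rid_tmul]
        exact Submodule.smul_mem _ _ y.2
    · rintro _ ⟨z, rfl⟩
      induction z with
      | zero => simp
      | add y z hy hz => rw [map_add]; exact add_mem hy hz
      | tmul y z => simp [hcoord z z.2]
  exact key (hI.comul_mem x hx)

namespace IsMonomial

variable [DecidableEq ι] (hD : D.IsMonomial b C)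

include hD

/-- The common kernel of the forms `ε ∘ ∂_w`, as an ideal of `TV`. -/
def derIdeal : Ideal (TensorAlgebra k V) :=
  { D.derKernel b with smul_mem' := fun a _ hx => hD.mul_mem_derKernel_left a hx }

theorem isBraidedBiideal_derIdeal : D.IsBraidedBiideal hD.derIdeal where
  isTwoSided := ⟨fun a hx => hD.mul_mem_derKernel_right a hx⟩
  homogeneous n x hx := hD.proj_mem_derKernel n hx
  degree_zero x hx h0 := by
    obtain ⟨r, rfl⟩ := Submodule.mem_one.1 (tensorPart_zero (k := k) (V := V) ▸ h0)
    have h : counit k V (algebraMap k _ r) = 0 := mem_derKernel.1 hx []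
    rw [AlgHom.commutes] at h
    change r = 0 at h
    rw [h, map_zero]
  degree_one x hx h1 := by
    rw [tensorPart, pow_one] at h1
    obtain ⟨v, rfl⟩ := h1
    have hv : v = 0 := by
      refine b.ext_elem fun i => ?_
      have h : D.derForm b [i] (TensorAlgebra.ι k v * 1) = 0 := by
        rw [mul_one]; exact mem_derKernel.1 hx [i]
      rw [derForm_cons, hD.skewDer_ι_mul] at h
      simpa [skewDer_one] using h
    rw [hv, map_zero]
  act_mem h x hx := hD.tensorAct_mem_derKernel h hx
  coact_mem g x hx := coactComponent_mem_derKernel hD g hx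
  comul_mem x hx := mem_range_sup_range_of_rid_derForm_mem _ fun w => by
    rw [hD.rid_derForm_comul]
    exact iterSkewDer_mem_derKernel w hx

/-- The defining ideal of the Nichols algebra is the common kernel of the iterated skew
derivations. -/
theorem mem_nicholsIdeal_iff {x : TensorAlgebra k V} :
    x ∈ D.nicholsIdeal ↔ x ∈ D.derKernel b := by
  constructor
  -- an ideal that is stable under all `∂ᵢ` and killed by `ε` is killed by all `ε ∂_w`
  · have : D.nicholsIdeal ≤ hD.derIdeal := by
      refine sSup_le fun I hI y hy => mem_derKernel.2 fun w => ?_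
      induction w generalizing y with
      | nil =>
        rw [map_eq_map_proj _ (fun l hl z hz => ?_) y (n := 0),
          hI.degree_zero _ (hI.homogeneous 0 hy) (SetLike.coe_mem _), map_zero]
        exact hD.derForm_eq_zero_of_length_ne (w := []) (by simpa using hl.symm) hz
      | cons i w ih => exact ih _ (IsBraidedBiideal.skewDer_mem hI i hy)
    exact fun hx => this hx
  · intro hx
    exact le_sSup (a := hD.derIdeal) hD.isBraidedBiideal_derIdeal hx

end IsMonomial

end NicholsIdeal

end YetterDrinfeld

/-! ### Ranks of integer matrices -/

section IntegerMatrices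

variable {m n : Type*} [Fintype n]

/-- Linear maps with the same source and the same kernel have images of the same rank. -/
theorem LinearMap.finrank_range_eq_of_ker_eq {R M N N' : Type*} [Ring R] [AddCommGroup M]
    [AddCommGroup N] [AddCommGroup N'] [Module R M] [Module R N] [Module R N']
    {f : M →ₗ[R] N} {f' : M →ₗ[R] N'} (h : LinearMap.ker f = LinearMap.ker f') :
    Module.finrank R (LinearMap.range f) = Module.finrank R (LinearMap.range f') :=
  (f.quotKerEquivRange.symm ≪≫ₗ Submodule.quotEquivOfEq _ _ h ≪≫ₗ
    f'.quotKerEquivRange).finrank_eq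

theorem Matrix.map_intCast_mulVec {k : Type*} [CommRing k] (A : Matrix m n ℤ) (c : n → ℤ) :
    (A.map (Int.cast : ℤ → k)).mulVec (fun j => (c j : k)) = fun i => (A.mulVec c i : k) := by
  ext i
  simp [Matrix.mulVec, dotProduct]

/-- Over any ring, the column space of an integer matrix is spanned by the image of a `ℤ`-basis of
the lattice of columns. -/
theorem Matrix.range_mulVecLin_map_intCast {k r : Type*} [CommRing k] (A : Matrix m n ℤ)
    (e : Module.Basis r ℤ (LinearMap.range A.mulVecLin)) :
    LinearMap.range (A.map (Int.cast : ℤ → k)).mulVecLin =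
      Submodule.span k (Set.range fun l i => ((e l : m → ℤ) i : k)) := by
  classical
  apply le_antisymm
  · rw [Matrix.range_mulVecLin, Submodule.span_le]
    rintro _ ⟨j, rfl⟩
    have hj : A.col j ∈ LinearMap.range A.mulVecLin := ⟨Pi.single j 1, by simp⟩
    have h := e.linearCombination_repr ⟨_, hj⟩
    have h' : ∀ i, A i j = ((e.repr ⟨_, hj⟩).sum fun l z => z * (e l : m → ℤ) i) := by
      intro i
      have := congrArg (fun y : LinearMap.range A.mulVecLin => (y : m → ℤ) i) h
      simp only [Finsupp.linearCombination_apply, Finsupp.sum] at this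
      rw [← Matrix.col_apply A j i, ← this, Finsupp.sum]
      simp
    have h2 : (A.map (Int.cast : ℤ → k)).col j = (e.repr ⟨_, hj⟩).sum fun l z =>
        (z : k) • fun i => ((e l : m → ℤ) i : k) := by
      ext i
      simp only [Matrix.col_apply, Matrix.map_apply, h' i, Finsupp.sum]
      simp
    rw [h2]
    exact Submodule.sum_mem _ fun l _ => Submodule.smul_mem _ _ (Submodule.subset_span ⟨l, rfl⟩)
  · rw [Submodule.span_le]
    rintro _ ⟨l, rfl⟩
    obtain ⟨c, hc⟩ := (e l).2
    refine ⟨fun j => (c j : k), ?_⟩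
    rw [Matrix.mulVecLin_apply, Matrix.map_intCast_mulVec]
    ext i
    exact congrArg Int.cast (congrFun hc i)

theorem Matrix.rank_map_ratCast [Finite m] (A : Matrix m n ℤ) :
    (A.map (Int.cast : ℤ → ℚ)).rank = Module.finrank ℤ (LinearMap.range A.mulVecLin) := by
  let e := Module.finBasis ℤ (LinearMap.range A.mulVecLin)
  rw [Matrix.rank, Matrix.range_mulVecLin_map_intCast A e]
  have h1 : LinearIndependent ℤ fun l i => ((e l : m → ℤ) i : ℚ) := by
    have := e.linearIndependent.map' ((LinearMap.range A.mulVecLin).subtype) (by simp)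
    refine this.map' ((Int.castAddHom ℚ).toIntLinearMap.compLeft m) ?_
    rw [LinearMap.ker_eq_bot]
    intro x y hxy
    ext i
    simpa using congrFun hxy i
  rw [finrank_span_eq_card ((LinearIndependent.iff_fractionRing ℤ ℚ).1 h1), Fintype.card_fin]

theorem Matrix.rank_map_zmodCast_le [Finite m] (p : ℕ) [Fact p.Prime] (A : Matrix m n ℤ) :
    (A.map (Int.cast : ℤ → ZMod p)).rank ≤ Module.finrank ℤ (LinearMap.range A.mulVecLin) := by
  let e := Module.finBasis ℤ (LinearMap.range A.mulVecLin)
  rw [Matrix.rank, Matrix.range_mulVecLin_map_intCast A e]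
  exact (finrank_range_le_card _).trans (by simp)

/-- If `ℤⁿ → ℤʳ` is surjective and its reduction mod `p` factors through the reduction of an integer
matrix `A`, then `A` has rank at least `r` mod `p`. -/
theorem Matrix.le_rank_map_zmodCast [Finite m] (p : ℕ) [Fact p.Prime] (A : Matrix m n ℤ) {r : ℕ}
    (f : (n → ℤ) →ₗ[ℤ] (Fin r → ℤ)) (hf : Function.Surjective f)
    (h : ∀ c, (∀ i, (p : ℤ) ∣ A.mulVec c i) → ∀ j, (p : ℤ) ∣ f c j) :
    r ≤ (A.map (Int.cast : ℤ → ZMod p)).rank := by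
  classical
  let B := LinearMap.toMatrix' f
  let A' := A.map (Int.cast : ℤ → ZMod p)
  let B' := B.map (Int.cast : ℤ → ZMod p)
  have hB : ∀ c, B.mulVec c = f c := fun c => by
    rw [← Matrix.toLin'_apply, Matrix.toLin'_toMatrix']
  have hlift : ∀ c : n → ZMod p, ∃ d : n → ℤ, (fun j => (d j : ZMod p)) = c :=
    fun c => ⟨fun j => (c j).cast, by ext; simp⟩
  have hlift' : ∀ c : Fin r → ZMod p, ∃ d : Fin r → ℤ, (fun j => (d j : ZMod p)) = c :=
    fun c => ⟨fun j => (c j).cast, by ext; simp⟩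
  have hsurj : LinearMap.range B'.mulVecLin = ⊤ := by
    rw [LinearMap.range_eq_top]
    intro y
    obtain ⟨d, rfl⟩ := hlift' y
    obtain ⟨c, rfl⟩ := hf d
    exact ⟨fun j => (c j : ZMod p), by
      rw [Matrix.mulVecLin_apply, Matrix.map_intCast_mulVec, hB]⟩
  have hker : LinearMap.ker A'.mulVecLin ≤ LinearMap.ker B'.mulVecLin := by
    intro c hc
    obtain ⟨d, rfl⟩ := hlift c
    rw [LinearMap.mem_ker, Matrix.mulVecLin_apply, Matrix.map_intCast_mulVec] at hc ⊢
    ext j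
    rw [hB]
    exact (ZMod.intCast_zmod_eq_zero_iff_dvd _ p).2 (h d
      (fun i => (ZMod.intCast_zmod_eq_zero_iff_dvd _ p).1 (congrFun hc i)) j)
  have h1 := A'.mulVecLin.finrank_range_add_finrank_ker
  have h2 := B'.mulVecLin.finrank_range_add_finrank_ker
  have h3 := Submodule.finrank_mono hker
  rw [hsurj, finrank_top, Module.finrank_fin_fun] at h2
  change r ≤ Module.finrank (ZMod p) (LinearMap.range A'.mulVecLin)
  omega

end IntegerMatrices

/-! ### Nichols algebras as ranks of matrices -/

namespace YetterDrinfeld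

section DerMatrix

variable {k G V ι : Type*} [CommRing k] [Group G] [AddCommGroup V] [Module k V]
variable (D : YetterDrinfeld k G V) (b : Module.Basis ι k V) {C : MonomialData G ι}

/-- The monomial in `TV` that belongs to a word in the basis `b`. -/
def word (w : List ι) : TensorAlgebra k V := (w.map fun i => TensorAlgebra.ι k (b i)).prod

@[simp]
theorem word_nil : word b [] = 1 := rfl

@[simp]
theorem word_cons (i : ι) (w : List ι) : word b (i :: w) = TensorAlgebra.ι k (b i) * word b w := by
  simp [word]

theorem tensorPart_eq_span (n : ℕ) :
    tensorPart k V n = Submodule.span k (Set.range fun u : Fin n → ι => word b (List.ofFn u)) := by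
  induction n with
  | zero =>
    rw [tensorPart_zero, Submodule.one_eq_span]
    simp
  | succ n ih =>
    have h : LinearMap.range (TensorAlgebra.ι k) =
        Submodule.span k (Set.range fun i => TensorAlgebra.ι k (b i)) := by
      rw [LinearMap.range_eq_map, ← b.span_eq, Submodule.map_span, ← Set.range_comp]
      rfl
    rw [tensorPart_succ, ih, h, Submodule.span_mul_span]
    congr 1
    ext x
    simp only [Set.mem_mul, Set.mem_range]
    constructor
    · rintro ⟨_, ⟨i, rfl⟩, _, ⟨u, rfl⟩, rfl⟩
      exact ⟨Fin.cons i u, by simp [List.ofFn_succ]⟩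
    · rintro ⟨u, rfl⟩
      exact ⟨_, ⟨u 0, rfl⟩, _, ⟨Fin.tail u, rfl⟩, by simp [List.ofFn_succ]; rfl⟩

/-- The matrix of the numbers `ε ∂_w u` for words `w, u` of length `n`. -/
def derMatrix (n : ℕ) : Matrix (Fin n → ι) (Fin n → ι) k :=
  Matrix.of fun w u => D.derForm b (List.ofFn w) (word b (List.ofFn u))

/-- The element of `Tⁿ V` with the given coordinates with respect to the words of length `n`. -/
def ofWordCoords [Fintype ι] (n : ℕ) : ((Fin n → ι) → k) →ₗ[k] TensorAlgebra k V :=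
  Fintype.linearCombination k fun u => word b (List.ofFn u)

theorem range_ofWordCoords [Fintype ι] (n : ℕ) :
    LinearMap.range (ofWordCoords (k := k) b n) = tensorPart k V n := by
  rw [ofWordCoords, Fintype.range_linearCombination, tensorPart_eq_span b]

theorem derForm_ofWordCoords [Fintype ι] {n : ℕ} (c : (Fin n → ι) → k) (w : Fin n → ι) :
    D.derForm b (List.ofFn w) (ofWordCoords b n c) = (D.derMatrix b n).mulVec c w := by
  simp [ofWordCoords, Fintype.linearCombination_apply, derMatrix, Matrix.mulVec, dotProduct,
    mul_comm]

variable {D b}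

theorem IsMonomial.ofWordCoords_mem_derKernel_iff [Fintype ι] [DecidableEq ι]
    (hD : D.IsMonomial b C) {n : ℕ} (c : (Fin n → ι) → k) :
    ofWordCoords b n c ∈ D.derKernel b ↔ (D.derMatrix b n).mulVec c = 0 := by
  rw [mem_derKernel]
  constructor
  · intro h
    ext w
    rw [← derForm_ofWordCoords, h]
    rfl
  · intro h w
    by_cases hw : w.length = n
    · subst hw
      have := congrFun h w.get
      rwa [← derForm_ofWordCoords, List.ofFn_get] at this
    · exact hD.derForm_eq_zero_of_length_ne hw (range_ofWordCoords (k := k) b n ▸ ⟨c, rfl⟩)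

variable (D b) in
/-- All forms `ε ∘ ∂_w` for words of length `n`. -/
def derForms (n : ℕ) : TensorAlgebra k V →ₗ[k] ((Fin n → ι) → k) :=
  LinearMap.pi fun w => D.derForm b (List.ofFn w)

theorem derForms_eq_zero_iff {n : ℕ} {x : TensorAlgebra k V} :
    D.derForms b n x = 0 ↔ ∀ w : List ι, w.length = n → D.derForm b w x = 0 := by
  constructor
  · rintro hx w rfl
    have := congrFun hx w.get
    simpa [derForms] using this
  · intro hx
    ext w
    exact hx _ (by simp)

theorem derForms_ofWordCoords [Fintype ι] {n : ℕ} (c : (Fin n → ι) → k) :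
    D.derForms b n (ofWordCoords b n c) = (D.derMatrix b n).mulVec c := by
  ext w
  exact derForm_ofWordCoords D b c w

theorem IsMonomial.derForms_mem_range [Fintype ι] [DecidableEq ι] (hD : D.IsMonomial b C) (n : ℕ)
    (x : TensorAlgebra k V) :
    D.derForms b n x ∈ LinearMap.range (D.derMatrix b n).mulVecLin := by
  have h1 : D.derForms b n x =
      D.derForms b n (DirectSum.decompose (tensorPart k V) x n : TensorAlgebra k V) :=
    map_eq_map_proj _ (fun l hl y hy => derForms_eq_zero_iff.2 fun w hw =>
      hD.derForm_eq_zero_of_length_ne (by omega) hy) x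
  have h2 : (DirectSum.decompose (tensorPart k V) x n : TensorAlgebra k V) ∈
      LinearMap.range (ofWordCoords (k := k) b n) := by
    rw [range_ofWordCoords]
    exact SetLike.coe_mem _
  obtain ⟨c, hc⟩ := h2
  rw [h1, ← hc, derForms_ofWordCoords]
  exact ⟨c, rfl⟩

/-- The dimension of the Nichols algebra in degree `n` is the rank of the matrix of iterated
skew derivations. -/
theorem IsMonomial.finrank_nicholsPart {k V : Type*} [Field k] [AddCommGroup V] [Module k V]
    {D : YetterDrinfeld k G V} {b : Module.Basis ι k V} [Fintype ι] [DecidableEq ι]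
    (hD : D.IsMonomial b C) (n : ℕ) :
    Module.finrank k (D.nicholsPart n) = (D.derMatrix b n).rank := by
  have h : D.nicholsPart n = LinearMap.range
      ((Ideal.Quotient.mkₐ k D.nicholsIdeal).toLinearMap ∘ₗ ofWordCoords b n) := by
    rw [LinearMap.range_comp, range_ofWordCoords]
    rfl
  rw [h, Matrix.rank]
  apply LinearMap.finrank_range_eq_of_ker_eq
  ext c
  rw [LinearMap.mem_ker, LinearMap.mem_ker, Matrix.mulVecLin_apply,
    ← hD.ofWordCoords_mem_derKernel_iff, ← hD.mem_nicholsIdeal_iff]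
  exact Ideal.Quotient.eq_zero_iff_mem

end DerMatrix

/-! ### Base change from the integers -/

section BaseChange

variable {k G V L ι : Type*} [CommRing k] [Group G] [AddCommGroup V] [Module k V] [AddCommGroup L]
variable (bL : Module.Basis ι ℤ L) (b : Module.Basis ι k V)

/-- The ring homomorphism `TL → TV` that maps the basis `bL` of a lattice `L` to the basis `b`. -/
def tensorMap : TensorAlgebra ℤ L →+* TensorAlgebra k V :=
  (TensorAlgebra.lift ℤ (bL.constr ℤ fun i => TensorAlgebra.ι k (b i))).toRingHom

theorem tensorMap_ι (i : ι) :
    tensorMap bL b (TensorAlgebra.ι ℤ (bL i)) = TensorAlgebra.ι k (b i) := by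
  change TensorAlgebra.lift ℤ (bL.constr ℤ fun i => TensorAlgebra.ι k (b i)) _ = _
  rw [TensorAlgebra.lift_ι_apply, Module.Basis.constr_basis]

theorem tensorMap_word (w : List ι) : tensorMap bL b (word bL w) = word b w := by
  induction w with
  | nil => simp
  | cons i w ih => rw [word_cons, word_cons, map_mul, tensorMap_ι, ih]

/-- Two additive maps on `TL` agree if they agree at `1` and their agreement at `x` implies their
agreement at `bL i * x`. -/
theorem addMonoidHom_ext_of_ι_mul {N : Type*} [AddCommGroup N] {f f' : TensorAlgebra ℤ L →+ N}
    (h1 : f 1 = f' 1) (hf : ∀ i x, f x = f' x →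
      f (TensorAlgebra.ι ℤ (bL i) * x) = f' (TensorAlgebra.ι ℤ (bL i) * x))
    (x : TensorAlgebra ℤ L) : f x = f' x :=
  linearMap_ext_of_ι_mul bL (f := f.toIntLinearMap) (f' := f'.toIntLinearMap) h1 hf x

variable {E : YetterDrinfeld ℤ G L} {D : YetterDrinfeld k G V} {C : MonomialData G ι} {bL b}
variable (hE : E.IsMonomial bL C) (hD : D.IsMonomial b C)

include hE hD

theorem tensorMap_tensorAct (h : G) (x : TensorAlgebra ℤ L) :
    tensorMap bL b (E.tensorAct h x) = D.tensorAct h (tensorMap bL b x) := by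
  refine addMonoidHom_ext_of_ι_mul bL
    (f := (tensorMap bL b).toAddMonoidHom.comp (E.tensorAct h).toRingHom.toAddMonoidHom)
    (f' := (D.tensorAct h).toRingHom.toAddMonoidHom.comp (tensorMap bL b).toAddMonoidHom) ?_ ?_ x
  · simp
  · intro i x hx
    change tensorMap bL b (E.tensorAct h x) = D.tensorAct h (tensorMap bL b x) at hx
    change tensorMap bL b (E.tensorAct h _) = D.tensorAct h (tensorMap bL b _)
    rw [hE.tensorAct_ι_mul, map_zsmul, map_mul, map_mul, tensorMap_ι, tensorMap_ι, hx,
      hD.tensorAct_ι_mul]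

theorem tensorMap_skewDer [DecidableEq ι] (i : ι) (x : TensorAlgebra ℤ L) :
    tensorMap bL b (E.skewDer bL i x) = D.skewDer b i (tensorMap bL b x) := by
  refine addMonoidHom_ext_of_ι_mul bL
    (f := (tensorMap bL b).toAddMonoidHom.comp (E.skewDer bL i).toAddMonoidHom)
    (f' := (D.skewDer b i).toAddMonoidHom.comp (tensorMap bL b).toAddMonoidHom) ?_ ?_ x
  · simp [skewDer_one]
  · intro j x hx
    change tensorMap bL b (E.skewDer bL i x) = D.skewDer b i (tensorMap bL b x) at hx
    change tensorMap bL b (E.skewDer bL i _) = D.skewDer b i (tensorMap bL b _)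
    rw [hE.skewDer_basis_mul, map_add, map_mul, map_mul, tensorMap_ι, hx, hD.skewDer_basis_mul]
    congr 1
    split_ifs
    · exact tensorMap_tensorAct hE hD _ x
    · exact map_zero _

theorem derForm_tensorMap [DecidableEq ι] (w : List ι) (x : TensorAlgebra ℤ L) :
    D.derForm b w (tensorMap bL b x) = (E.derForm bL w x : k) := by
  induction w generalizing x with
  | nil =>
    refine addMonoidHom_ext_of_ι_mul bL
      (f := (counit k V).toRingHom.toAddMonoidHom.comp (tensorMap bL b).toAddMonoidHom)
      (f' := (Int.castAddHom k).comp (counit ℤ L).toRingHom.toAddMonoidHom) ?_ ?_ x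
    · simp
    · intro j x _
      change counit k V (tensorMap bL b _) = ((counit ℤ L _ : ℤ) : k)
      rw [map_mul, map_mul, map_mul, tensorMap_ι, counit_ι, counit_ι]
      simp
  | cons i w ih => rw [derForm_cons, ← tensorMap_skewDer hE hD, ih, derForm_cons]

theorem derMatrix_eq_map_intCast [DecidableEq ι] (n : ℕ) :
    D.derMatrix b n = (E.derMatrix bL n).map (Int.cast : ℤ → k) := by
  ext w u
  simp [derMatrix, ← tensorMap_word bL b, derForm_tensorMap hE hD]

end BaseChange

end YetterDrinfeld

/-! ### Duality with respect to the top degree -/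

namespace YetterDrinfeld

section Frobenius

variable {G L ι : Type*} [Group G] [AddCommGroup L]

section

variable {k V : Type*} [CommRing k] [AddCommGroup V] [Module k V]
variable {D : YetterDrinfeld k G V} {b : Module.Basis ι k V} {C : MonomialData G ι}

variable (D) in
/-- The left slice `(φ ⊗ id) (Δ y)` of the comultiplication. -/
def leftSlice (φ : TensorAlgebra k V →ₗ[k] k) : TensorAlgebra k V →ₗ[k] TensorAlgebra k V :=
  (TensorProduct.lid k (TensorAlgebra k V)).toLinearMap ∘ₗ
    φ.rTensor (TensorAlgebra k V) ∘ₗ D.comul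

theorem leftSlice_add (φ ψ : TensorAlgebra k V →ₗ[k] k) (y : TensorAlgebra k V) :
    leftSlice D (φ + ψ) y = leftSlice D φ y + leftSlice D ψ y := by
  simp [leftSlice, LinearMap.rTensor_add]

theorem leftSlice_smul (r : k) (φ : TensorAlgebra k V →ₗ[k] k) (y : TensorAlgebra k V) :
    leftSlice D (r • φ) y = r • leftSlice D φ y := by
  simp [leftSlice, LinearMap.rTensor_smul]

theorem IsMonomial.leftSlice_basis_mul (hD : D.IsMonomial b C) (φ : TensorAlgebra k V →ₗ[k] k)
    (i : ι) (y : TensorAlgebra k V) :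
    leftSlice D φ (TensorAlgebra.ι k (b i) * y) =
      leftSlice D (φ ∘ₗ LinearMap.mulLeft k (TensorAlgebra.ι k (b i))) y +
        TensorAlgebra.ι k (b i) *
          leftSlice D (φ ∘ₗ (D.tensorAct (C.deg i)).toLinearMap) y := by
  have key : (TensorProduct.lid k (TensorAlgebra k V)).toLinearMap ∘ₗ
      φ.rTensor (TensorAlgebra k V) ∘ₗ D.comulMul (b i) =
      (TensorProduct.lid k (TensorAlgebra k V)).toLinearMap ∘ₗ
        (φ ∘ₗ LinearMap.mulLeft k (TensorAlgebra.ι k (b i))).rTensor (TensorAlgebra k V) +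
      LinearMap.mulLeft k (TensorAlgebra.ι k (b i)) ∘ₗ
        (TensorProduct.lid k (TensorAlgebra k V)).toLinearMap ∘ₗ
          (φ ∘ₗ (D.tensorAct (C.deg i)).toLinearMap).rTensor (TensorAlgebra k V) := by
    refine TensorProduct.ext' fun x z => ?_
    simp [hD.comulMul_basis]
  have := LinearMap.congr_fun key (D.comul y)
  simp only [LinearMap.comp_apply, LinearMap.add_apply] at this
  simp only [leftSlice, LinearMap.comp_apply, comul_ι_mul]
  exact this

/-- `ε ∂_w ((φ ⊗ id) (Δ y)) = φ (∂_w y)` -/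
theorem IsMonomial.derForm_leftSlice [DecidableEq ι] (hD : D.IsMonomial b C)
    (φ : TensorAlgebra k V →ₗ[k] k) (w : List ι) (y : TensorAlgebra k V) :
    D.derForm b w (leftSlice D φ y) = φ (D.iterSkewDer b w y) := by
  have key : D.derForm b w ∘ₗ (TensorProduct.lid k (TensorAlgebra k V)).toLinearMap ∘ₗ
      φ.rTensor (TensorAlgebra k V) = φ ∘ₗ (TensorProduct.rid k (TensorAlgebra k V)).toLinearMap ∘ₗ
      (D.derForm b w).lTensor (TensorAlgebra k V) := by
    refine TensorProduct.ext' fun x z => ?_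
    simp [mul_comm]
  rw [← hD.rid_derForm_comul]
  exact LinearMap.congr_fun key (D.comul y)

theorem one_mem_tensorPart_zero : (1 : TensorAlgebra k V) ∈ tensorPart k V 0 := by
  rw [tensorPart_zero]
  exact Submodule.one_le.1 le_rfl

theorem derForm_iterSkewDer (u w : List ι) (x : TensorAlgebra k V) :
    D.derForm b w (D.iterSkewDer b u x) = D.derForm b (u ++ w) x := by
  induction u generalizing x with
  | nil => rfl
  | cons i u ih => exact ih _

end

variable {E : YetterDrinfeld ℤ G L} {b : Module.Basis ι ℤ L} {C : MonomialData G ι}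
/-- Let `K` be the common kernel `derKernel`. A linear form on `TL` that identifies the component of degree `m` of `TL / K`, free of rank one,
with `ℤ`, together with a representative `top` of the generator. -/
structure TopForm (E : YetterDrinfeld ℤ G L) (b : Module.Basis ι ℤ L) (m : ℕ) where
  /-- the linear form -/
  form : TensorAlgebra ℤ L →ₗ[ℤ] ℤ
  /-- the generator in degree `m` -/
  top : TensorAlgebra ℤ L
  top_mem : top ∈ tensorPart ℤ L m
  form_top : form top = 1
  form_eq_zero_iff : ∀ x, form x = 0 ↔ ∀ w : List ι, w.length = m → E.derForm b w x = 0

theorem IsMonomial.nonempty_topForm [Fintype ι] [DecidableEq ι] (hE : E.IsMonomial b C) {m : ℕ}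
    (h : Module.finrank ℤ (LinearMap.range (E.derMatrix b m).mulVecLin) = 1) :
    Nonempty (TopForm E b m) := by
  obtain ⟨e⟩ : Nonempty (LinearMap.range (E.derMatrix b m).mulVecLin ≃ₗ[ℤ] ℤ) :=
    ⟨LinearEquiv.ofFinrankEq _ _ (by rw [h, Module.finrank_self])⟩
  obtain ⟨⟨_, c, rfl⟩, hc⟩ := e.surjective 1
  refine ⟨⟨e.toLinearMap ∘ₗ (E.derForms b m).codRestrict _ (hE.derForms_mem_range m),
    ofWordCoords b m c, ?_, ?_, fun x => ?_⟩⟩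
  · exact range_ofWordCoords (k := ℤ) b m ▸ ⟨c, rfl⟩
  · refine Eq.trans (congrArg e (Subtype.ext ?_)) hc
    exact derForms_ofWordCoords c
  · rw [LinearMap.comp_apply, LinearEquiv.coe_coe, LinearEquiv.map_eq_zero_iff, Subtype.ext_iff]
    exact derForms_eq_zero_iff

namespace TopForm

variable {m : ℕ} (t : TopForm E b m)

theorem form_eq_zero_of_mem {x : TensorAlgebra ℤ L} (hx : x ∈ E.derKernel b) : t.form x = 0 :=
  (t.form_eq_zero_iff x).2 fun w _ => mem_derKernel.1 hx w

theorem derForm_eq_form_mul {w : List ι} (hw : w.length = m) (x : TensorAlgebra ℤ L) :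
    E.derForm b w x = t.form x * E.derForm b w t.top := by
  have h : t.form (x - t.form x • t.top) = 0 := by
      rw [map_sub, map_smul, t.form_top, smul_eq_mul, mul_one, sub_self]
  have := (t.form_eq_zero_iff _).1 h w hw
  rw [map_sub, map_smul, smul_eq_mul] at this
  exact sub_eq_zero.1 this

/-- The group acts on the top degree by signs. -/
theorem exists_unit_form_tensorAct [DecidableEq ι] (hE : E.IsMonomial b C) (h : G) :
    ∃ χ : ℤ, IsUnit χ ∧ ∀ x, t.form (E.tensorAct h x) = χ * t.form x := by
  have key : ∀ h x, t.form (E.tensorAct h x) = t.form (E.tensorAct h t.top) * t.form x := by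
    intro h x
    have h0 : t.form (x - t.form x • t.top) = 0 := by
      rw [map_sub, map_smul, t.form_top, smul_eq_mul, mul_one, sub_self]
    have h1 : t.form (E.tensorAct h (x - t.form x • t.top)) = 0 := by
      rw [t.form_eq_zero_iff] at h0 ⊢
      exact fun w hw => hE.derForm_tensorAct_eq_zero h w fun u hu => h0 u (hu.trans hw)
    rw [map_sub, map_smul, map_sub, map_smul, smul_eq_mul, sub_eq_zero] at h1
    rw [h1, mul_comm]
  refine ⟨_, ?_, key h⟩
  refine IsUnit.of_mul_eq_one (t.form (E.tensorAct h⁻¹ t.top)) ?_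
  rw [← key, ← tensorAct_mul_apply, mul_inv_cancel, tensorAct_one_apply, t.form_top]

/-- The map `x ↦ (λ(x ·) ⊗ id) (Δ Λ)` for the form `λ` and the generator `Λ` of the top degree. -/
def dual : TensorAlgebra ℤ L →ₗ[ℤ] TensorAlgebra ℤ L where
  toFun x := leftSlice E (t.form ∘ₗ LinearMap.mulLeft ℤ x) t.top
  map_add' x y := by
    rw [← leftSlice_add, ← LinearMap.comp_add]
    congr 2
    ext z
    simp [add_mul]
  map_smul' r x := by
    rw [RingHom.id_apply, ← leftSlice_smul, ← LinearMap.comp_smul]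
    congr 3
    refine LinearMap.ext fun z => ?_
    exact smul_mul_assoc r x z

theorem dual_apply (x : TensorAlgebra ℤ L) :
    t.dual x = leftSlice E (t.form ∘ₗ LinearMap.mulLeft ℤ x) t.top := rfl

/-- `dual x` is divisible by `p` if the linear form `λ(x ·)` is. -/
theorem exists_dual_eq_smul {p : ℕ} {x : TensorAlgebra ℤ L}
    (hx : ∀ y, (p : ℤ) ∣ t.form (x * y)) : ∃ z, t.dual x = (p : ℤ) • z := by
  let φ : TensorAlgebra ℤ L →ₗ[ℤ] ℤ :=
    { toFun y := t.form (x * y) / p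
      map_add' y z := by rw [mul_add, map_add, Int.add_ediv_of_dvd_left (hx y)]
      map_smul' r y := by
        rw [mul_smul_comm, map_smul, smul_eq_mul, Int.mul_ediv_assoc _ (hx y)]; rfl }
  have h : t.form ∘ₗ LinearMap.mulLeft ℤ x = (p : ℤ) • φ := by
    refine LinearMap.ext fun y => ?_
    exact (Int.mul_ediv_cancel' (hx y)).symm
  exact ⟨leftSlice E φ t.top, by rw [dual_apply, h, leftSlice_smul]⟩

variable [DecidableEq ι]

theorem dual_one_sub_mem (hE : E.IsMonomial b C) : t.dual 1 - 1 ∈ E.derKernel b := by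
  rw [mem_derKernel]
  intro w
  rw [map_sub, dual_apply, hE.derForm_leftSlice]
  cases w with
  | nil => simp [iterSkewDer, t.form_top]
  | cons i w =>
    have h1 : E.derForm b (i :: w) 1 = 0 :=
      hE.derForm_eq_zero_of_length_ne (n := 0) (by simp) (one_mem_tensorPart_zero)
    have h2 : t.form (E.iterSkewDer b (i :: w) t.top) = 0 := by
      rw [t.form_eq_zero_iff]
      intro u hu
      rw [derForm_iterSkewDer]
      exact hE.derForm_eq_zero_of_length_ne (by simp; omega) t.top_mem
    simp [h1, h2]

/-- If everything in degree `m + 1` lies in `K`, then so does `(φ ⊗ id) Δ(vᵢ Λ)` for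
`φ = λ(x ·)`, and this gives a recursion for `dual` modulo `K`. -/
theorem dual_mul_ι_add_mem (hE : E.IsMonomial b C)
    (htop : tensorPart ℤ L (m + 1) ≤ E.derKernel b) (i : ι) {χ : ℤ}
    (hχ : ∀ x, t.form (E.tensorAct (C.deg i) x) = χ * t.form x) (x : TensorAlgebra ℤ L) :
    t.dual (E.tensorAct (C.deg i) x * TensorAlgebra.ι ℤ (b i)) +
      χ • (TensorAlgebra.ι ℤ (b i) * t.dual x) ∈ E.derKernel b := by
  have h1 : leftSlice E (t.form ∘ₗ LinearMap.mulLeft ℤ (E.tensorAct (C.deg i) x))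
      (TensorAlgebra.ι ℤ (b i) * t.top) ∈ E.derKernel b := by
    rw [mem_derKernel]
    intro w
    rw [hE.derForm_leftSlice]
    exact t.form_eq_zero_of_mem (hE.mul_mem_derKernel_left _
      (iterSkewDer_mem_derKernel w (htop (ι_mul_mem_tensorPart _ t.top_mem))))
  rw [hE.leftSlice_basis_mul] at h1
  have h2 : (t.form ∘ₗ LinearMap.mulLeft ℤ (E.tensorAct (C.deg i) x)) ∘ₗ
      LinearMap.mulLeft ℤ (TensorAlgebra.ι ℤ (b i)) =
      t.form ∘ₗ LinearMap.mulLeft ℤ (E.tensorAct (C.deg i) x * TensorAlgebra.ι ℤ (b i)) := by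
    ext y
    simp
  have h3 : (t.form ∘ₗ LinearMap.mulLeft ℤ (E.tensorAct (C.deg i) x)) ∘ₗ
      (E.tensorAct (C.deg i)).toLinearMap = χ • (t.form ∘ₗ LinearMap.mulLeft ℤ x) := by
    ext y
    simp [← hχ]
  rw [h2, h3, leftSlice_smul, mul_smul_comm] at h1
  exact h1

/-- `dual` is surjective modulo `K` in each degree. -/
theorem exists_dual_sub_word_mem (hE : E.IsMonomial b C)
    (htop : tensorPart ℤ L (m + 1) ≤ E.derKernel b) (w : List ι) :
    ∃ x ∈ tensorPart ℤ L w.length, t.dual x - word b w ∈ E.derKernel b := by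
  induction w with
  | nil =>
    exact ⟨1, one_mem_tensorPart_zero, t.dual_one_sub_mem hE⟩
  | cons i w ih =>
    obtain ⟨x, hx, hxw⟩ := ih
    obtain ⟨χ, hχ, hform⟩ := t.exists_unit_form_tensorAct hE (C.deg i)
    obtain ⟨ψ, hψ⟩ := hχ.exists_right_inv
    -- `ψ` is the inverse of the sign `χ`, so that the scalar in the recursion cancels
    refine ⟨-ψ • (E.tensorAct (C.deg i) x * TensorAlgebra.ι ℤ (b i)),
      Submodule.smul_mem _ _ (mul_ι_mem_tensorPart _ (E.tensorAct_mem_tensorPart _ hx)), ?_⟩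
    have h1 := Submodule.smul_mem _ (-ψ) (t.dual_mul_ι_add_mem hE htop i hform x)
    have h2 := hE.ι_mul_mem_derKernel (b i) hxw
    have h3 := add_mem h1 h2
    convert h3 using 1
    rw [map_smul, smul_add, smul_smul, neg_mul, mul_comm ψ, hψ, mul_sub, word_cons]
    module

theorem tensorPart_le_map_dual_sup (hE : E.IsMonomial b C)
    (htop : tensorPart ℤ L (m + 1) ≤ E.derKernel b) (n : ℕ) :
    tensorPart ℤ L n ≤ (tensorPart ℤ L n).map t.dual ⊔ E.derKernel b := by
  refine (tensorPart_eq_span b n).trans_le (Submodule.span_le.2 ?_)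
  rintro _ ⟨u, rfl⟩
  obtain ⟨x, hx, hxu⟩ := t.exists_dual_sub_word_mem hE htop (List.ofFn u)
  rw [List.length_ofFn] at hx
  change word b (List.ofFn u) ∈ (tensorPart ℤ L n).map t.dual ⊔ E.derKernel b
  rw [← sub_sub_self (t.dual x) (word b (List.ofFn u))]
  exact sub_mem (Submodule.mem_sup_left ⟨x, hx, rfl⟩) (Submodule.mem_sup_right hxu)

end TopForm

/-- Let `TL / K` be concentrated in degrees `≤ m` and of rank one in degree `m`. If the degree `m`
does not vanish modulo `p`, then no rank drops modulo `p`. -/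
theorem finrank_range_derMatrix_le [Fintype ι] [DecidableEq ι] {p : ℕ} [Fact p.Prime]
    {V : Type*} [AddCommGroup V] [Module (ZMod p) V] {D : YetterDrinfeld (ZMod p) G V} {bV : Module.Basis ι (ZMod p) V}
    (hE : E.IsMonomial b C) (hD : D.IsMonomial bV C) {m : ℕ}
    (h1 : Module.finrank ℤ (LinearMap.range (E.derMatrix b m).mulVecLin) = 1)
    (h0 : E.derMatrix b (m + 1) = 0) (hp : D.derMatrix bV m ≠ 0) (n : ℕ) :
    Module.finrank ℤ (LinearMap.range (E.derMatrix b n).mulVecLin) ≤ (D.derMatrix bV n).rank := by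
  obtain ⟨t⟩ := hE.nonempty_topForm h1
  have htop : tensorPart ℤ L (m + 1) ≤ E.derKernel b := by
    rw [← range_ofWordCoords b]
    rintro _ ⟨c, rfl⟩
    rw [hE.ofWordCoords_mem_derKernel_iff, h0, Matrix.zero_mulVec]
  -- modulo `p`, the top degree is detected by one of the forms `ε ∂_w`
  obtain ⟨w, hw⟩ : ∃ w : Fin m → ι, ¬ (p : ℤ) ∣ E.derForm b (List.ofFn w) t.top := by
    by_contra! hdvd
    refine hp ?_
    ext w u
    rw [derMatrix_eq_map_intCast hE hD, Matrix.map_apply, derMatrix, Matrix.of_apply,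
      t.derForm_eq_form_mul (by simp), Int.cast_mul,
      (ZMod.intCast_zmod_eq_zero_iff_dvd _ p).2 (hdvd w), mul_zero]
    rfl
  -- the kernel modulo `p` is a right ideal, so `λ(x y)` is divisible by `p` along with `x`
  have hdvd : ∀ c, (∀ i, (p : ℤ) ∣ (E.derMatrix b n).mulVec c i) →
      ∀ y, (p : ℤ) ∣ t.form (ofWordCoords b n c * y) := by
    intro c hc y
    have hmem : tensorMap b bV (ofWordCoords b n c) ∈ D.derKernel bV := by
      rw [mem_derKernel]
      intro u
      rw [derForm_tensorMap hE hD, ZMod.intCast_zmod_eq_zero_iff_dvd]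
      by_cases hu : u.length = n
      · subst hu
        have := hc u.get
        rwa [← derForm_ofWordCoords, List.ofFn_get] at this
      · rw [hE.derForm_eq_zero_of_length_ne hu (range_ofWordCoords (k := ℤ) b n ▸ ⟨c, rfl⟩)]
        exact dvd_zero _
    have hmem' := mem_derKernel.1 (hD.mul_mem_derKernel_right (tensorMap b bV y) hmem) (List.ofFn w)
    rw [← map_mul, derForm_tensorMap hE hD, ZMod.intCast_zmod_eq_zero_iff_dvd,
      t.derForm_eq_form_mul (by simp)] at hmem'
    exact ((Nat.prime_iff_prime_int.1 Fact.out).dvd_or_dvd hmem').resolve_right hw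
  -- `e ∘ F ∘ dual` maps the words of length `n` onto `ℤʳ`, and it maps to `p ℤʳ` whatever vanishes
  -- in the Nichols algebra modulo `p`
  obtain ⟨e⟩ : Nonempty (LinearMap.range (E.derMatrix b n).mulVecLin ≃ₗ[ℤ]
      (Fin (Module.finrank ℤ (LinearMap.range (E.derMatrix b n).mulVecLin)) → ℤ)) :=
    ⟨(Module.finBasis ℤ _).equivFun⟩
  obtain ⟨F, hF⟩ : ∃ F : TensorAlgebra ℤ L →ₗ[ℤ] LinearMap.range (E.derMatrix b n).mulVecLin,
      ∀ x, (F x : (Fin n → ι) → ℤ) = E.derForms b n x :=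
    ⟨(E.derForms b n).codRestrict _ (hE.derForms_mem_range n), fun _ => rfl⟩
  refine Matrix.le_rank_map_zmodCast p (E.derMatrix b n)
    (e.toLinearMap ∘ₗ F ∘ₗ t.dual ∘ₗ ofWordCoords b n) ?_ ?_ |>.trans_eq ?_
  · intro y
    obtain ⟨z, rfl⟩ := e.surjective y
    obtain ⟨c, hc⟩ := z.2
    have hcn : ofWordCoords b n c ∈ tensorPart ℤ L n := range_ofWordCoords (k := ℤ) b n ▸ ⟨c, rfl⟩
    obtain ⟨_, ⟨x, hx, rfl⟩, κ, hκ, hsum⟩ :=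
      Submodule.mem_sup.1 (t.tensorPart_le_map_dual_sup hE htop n hcn)
    rw [← range_ofWordCoords b] at hx
    obtain ⟨c', rfl⟩ := hx
    refine ⟨c', congrArg e (Subtype.ext ?_)⟩
    rw [LinearMap.comp_apply, LinearMap.comp_apply, hF]
    have h2 : E.derForms b n κ = 0 := derForms_eq_zero_iff.2 fun w _ => mem_derKernel.1 hκ w
    rw [← hc, Matrix.mulVecLin_apply, ← derForms_ofWordCoords, ← hsum, map_add, h2, add_zero]
  · intro c hc j
    obtain ⟨z, hz⟩ := t.exists_dual_eq_smul (hdvd c hc)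
    have : (e.toLinearMap ∘ₗ F ∘ₗ t.dual ∘ₗ ofWordCoords b n) c = (p : ℤ) • e (F z) := by
      simp only [LinearMap.comp_apply, hz, map_smul, LinearEquiv.coe_coe]
    rw [this, Pi.smul_apply, smul_eq_mul]
    exact dvd_mul_right _ _
  · rw [derMatrix_eq_map_intCast hE hD]

end Frobenius

end YetterDrinfeld

/-! ### Monomial bases of the orbit lattice and its reductions -/

namespace YetterDrinfeld

section ReductionModP

variable {G L ι : Type*} [Group G] [AddCommGroup L]

theorem ModP.mk_eq_zero_iff {p : ℕ} {x : L} : ModP.mk p L x = 0 ↔ ∃ y, x = (p : ℤ) • y := by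
  refine (Submodule.Quotient.mk_eq_zero _).trans ?_
  simp only [LinearMap.mem_range, LinearMap.lsmul_apply, eq_comm]

theorem ModP.intCast_smul_mk (p : ℕ) (z : ℤ) (x : L) :
    (z : ZMod p) • ModP.mk p L x = ModP.mk p L (z • x) := by
  rw [Int.cast_smul_eq_zsmul, map_zsmul]

/-- The reduction mod `p` of a `ℤ`-basis of `L` is a basis of `L / p L`. -/
def ModP.basis (p : ℕ) (b : Module.Basis ι ℤ L) : Module.Basis ι (ZMod p) (ModP p L) :=
  Module.Basis.mk (v := fun i => ModP.mk p L (b i))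
    (by
      rw [linearIndependent_iff']
      intro s c hc i hi
      have h : ModP.mk p L (∑ j ∈ s, ((c j).cast : ℤ) • b j) = 0 := by
        rw [map_sum, ← hc]
        refine Finset.sum_congr rfl fun j _ => ?_
        rw [← ModP.intCast_smul_mk, ZMod.intCast_zmod_cast]
      obtain ⟨y, hy⟩ := ModP.mk_eq_zero_iff.1 h
      have h2 := congrArg (fun x => b.repr x i) hy
      classical
      simp only [map_sum, map_smul, Module.Basis.repr_self, Finsupp.coe_finsetSum,
        Finset.sum_apply, Finsupp.smul_apply, Finsupp.single_apply, smul_eq_mul, mul_ite, mul_one,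
        mul_zero, Finset.sum_ite_eq', hi, if_true] at h2
      rw [← ZMod.intCast_zmod_cast (c i), ZMod.intCast_zmod_eq_zero_iff_dvd, h2]
      exact dvd_mul_right _ _)
    (by
      intro x _
      obtain ⟨y, rfl⟩ := ModP.mk_surjective p x
      induction b.mem_span y using Submodule.span_induction with
      | mem y hy =>
        obtain ⟨i, rfl⟩ := hy
        exact Submodule.subset_span ⟨i, rfl⟩
      | zero => rw [map_zero]; exact zero_mem _
      | add y z _ _ hy hz => rw [map_add]; exact add_mem (hy trivial) (hz trivial)
      | smul n y _ hy =>
        rw [← ModP.intCast_smul_mk]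
        exact Submodule.smul_mem _ _ (hy trivial))

theorem ModP.basis_apply (p : ℕ) (b : Module.Basis ι ℤ L) (i : ι) :
    ModP.basis p b i = ModP.mk p L (b i) := by
  simp [ModP.basis]

theorem IsMonomial.modP {E : YetterDrinfeld ℤ G L} {b : Module.Basis ι ℤ L}
    {C : MonomialData G ι} (hE : E.IsMonomial b C) (p : ℕ) :
    (E.modP p).IsMonomial (ModP.basis p b) C where
  coact_basis i := by
    rw [ModP.basis_apply]
    change Finsupp.mapRange.addMonoidHom (ModP.mk p L) (E.coact (b i)) = _
    rw [hE.coact_basis]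
    simp
  act_basis h i := by
    rw [ModP.basis_apply, ModP.basis_apply]
    change ModP.mk p L (E.act h (b i)) = _
    rw [hE.act_basis, map_zsmul]

end ReductionModP

section Orbit

variable {G V : Type*} [Group G] [AddCommGroup V] [Module ℚ V]
variable {D : YetterDrinfeld ℚ G V} {g : G} {v : V}

theorem coact_act_eq_single (hv : D.coact v = Finsupp.single g v) (h : G) :
    D.coact (D.act h v) = Finsupp.single (h * g * h⁻¹) (D.act h v) := by
  ext y
  have h1 := D.coact_act h v (h⁻¹ * y * h)
  have h2 : h * (h⁻¹ * y * h) * h⁻¹ = y := by group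
  rw [h2, hv] at h1
  rw [h1]
  by_cases hy : y = h * g * h⁻¹
  · have : h⁻¹ * y * h = g := by rw [hy]; group
    rw [this, hy, Finsupp.single_eq_same, Finsupp.single_eq_same]
  · have : h⁻¹ * y * h ≠ g := fun h' => hy (by rw [← h']; group)
    rw [Finsupp.single_eq_of_ne this, Finsupp.single_eq_of_ne hy, map_zero]

/-- An element that conjugates `g` to `x`. -/
def conjugator (x : conjugatesOf g) : G := (isConj_iff.1 x.2).choose

theorem conjugator_spec (x : conjugatesOf g) : conjugator x * g * (conjugator x)⁻¹ = x :=
  (isConj_iff.1 x.2).choose_spec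

variable (D v) in
/-- The vector of the orbit of `v` in degree `x`, for `x` in the conjugacy class of `g`; it is
unique up to sign in the cases of interest. -/
def orbitVec (x : conjugatesOf g) : V := D.act (conjugator x) v

theorem coact_orbitVec (hv : D.coact v = Finsupp.single g v) (x : conjugatesOf g) :
    D.coact (D.orbitVec v x) = Finsupp.single (x : G) (D.orbitVec v x) := by
  rw [orbitVec, coact_act_eq_single hv, conjugator_spec]

theorem act_inv_act (h : G) (v : V) : D.act h⁻¹ (D.act h v) = v := by
  rw [← Module.End.mul_apply, ← map_mul, inv_mul_cancel, map_one, Module.End.one_apply]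

theorem orbitVec_ne_zero (hv0 : v ≠ 0) (x : conjugatesOf g) : D.orbitVec v x ≠ 0 := by
  intro h
  apply hv0
  rw [← act_inv_act (D := D) (conjugator x) v]
  rw [orbitVec] at h
  rw [h, map_zero]

theorem linearIndependent_orbitVec (hv0 : v ≠ 0) (hv : D.coact v = Finsupp.single g v) :
    LinearIndependent ℚ (D.orbitVec v : conjugatesOf g → V) := by
  classical
  rw [linearIndependent_iff']
  intro s c hc y hy
  have h := congrArg (fun u => D.coact u (y : G)) hc
  simp only [map_sum, map_smul, coact_orbitVec hv, map_zero, Finsupp.coe_finsetSum,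
    Finset.sum_apply, Finsupp.smul_apply, Finsupp.coe_zero, Pi.zero_apply] at h
  rw [Finset.sum_eq_single y] at h
  · rw [Finsupp.single_eq_same] at h
    exact (smul_eq_zero.1 h).resolve_right (orbitVec_ne_zero hv0 y)
  · intro x _ hx
    rw [Finsupp.single_eq_of_ne (fun h' => hx (Subtype.ext h'.symm)), smul_zero]
  · exact fun h' => absurd hy h'

/-- Conjugation by `h` on the conjugacy class of `g`. -/
def conjPerm (g h : G) : conjugatesOf g ≃ conjugatesOf g where
  toFun x := ⟨h * x * h⁻¹, x.2.trans (isConj_iff.2 ⟨h, rfl⟩)⟩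
  invFun x := ⟨h⁻¹ * x * h, x.2.trans (isConj_iff.2 ⟨h⁻¹, by simp⟩)⟩
  left_inv x := Subtype.ext (by group)
  right_inv x := Subtype.ext (by group)

/-- If the centralizer of `g` acts on `v` by signs, then the orbit of `v` consists of the vectors
`± orbitVec v x`. -/
theorem act_eq_orbitVec_or_neg
    (hsign : ∀ c ∈ Subgroup.centralizer ({g} : Set G), D.act c v = v ∨ D.act c v = -v)
    (h : G) (x : conjugatesOf g) (hx : h * g * h⁻¹ = x) :
    D.act h v = D.orbitVec v x ∨ D.act h v = -D.orbitVec v x := by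
  have hc : (conjugator x)⁻¹ * h ∈ Subgroup.centralizer ({g} : Set G) := by
    rw [Subgroup.mem_centralizer_singleton_iff]
    have h1 : h * g = conjugator x * g * (conjugator x)⁻¹ * h := by
      rw [conjugator_spec, ← hx]; group
    rw [mul_assoc, h1]
    group
  have h2 : D.act h v = D.act (conjugator x) (D.act ((conjugator x)⁻¹ * h) v) := by
    rw [← Module.End.mul_apply, ← map_mul, mul_inv_cancel_left]
  rw [h2, orbitVec]
  rcases hsign _ hc with h3 | h3
  · exact Or.inl (by rw [h3])
  · exact Or.inr (by rw [h3, map_neg])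

open Classical in
variable (D g v) in
/-- The monomial data of the orbit of `v`. -/
def orbitData : MonomialData G (conjugatesOf g) where
  deg x := x
  perm := conjPerm g
  sgn h x := if D.act h (D.orbitVec v x) = D.orbitVec v (conjPerm g h x) then 1 else -1
  deg_perm _ _ := rfl

theorem act_orbitVec
    (hsign : ∀ c ∈ Subgroup.centralizer ({g} : Set G), D.act c v = v ∨ D.act c v = -v)
    (h : G) (x : conjugatesOf g) :
    D.act h (D.orbitVec v x) =
      (orbitData D g v).sgn h x • D.orbitVec v ((orbitData D g v).perm h x) := by
  have h1 : D.act h (D.orbitVec v x) = D.act (h * conjugator x) v := by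
    rw [map_mul, Module.End.mul_apply, orbitVec]
  have h2 : (h * conjugator x) * g * (h * conjugator x)⁻¹ = conjPerm g h x := by
    change _ = h * (x : G) * h⁻¹
    rw [← conjugator_spec x]
    group
  have h3 := act_eq_orbitVec_or_neg hsign _ _ h2
  rw [← h1] at h3
  simp only [orbitData]
  split_ifs with h4
  · rw [one_smul, h4]
  · rw [neg_smul, one_smul, h3.resolve_left h4]

theorem span_int_orbitVec
    (hsign : ∀ c ∈ Subgroup.centralizer ({g} : Set G), D.act c v = v ∨ D.act c v = -v) :
    D.lattice v = Submodule.span ℤ (Set.range (D.orbitVec v : conjugatesOf g → V)) := by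
  apply le_antisymm
  · refine Submodule.span_le.2 ?_
    rintro _ ⟨h, rfl⟩
    have hx : h * g * h⁻¹ ∈ conjugatesOf g := isConj_iff.2 ⟨h, rfl⟩
    have hmem := Submodule.subset_span (R := ℤ)
      (Set.mem_range_self (f := (D.orbitVec v : conjugatesOf g → V)) ⟨_, hx⟩)
    rcases act_eq_orbitVec_or_neg hsign h ⟨_, hx⟩ rfl with h1 | h1
    · simpa only [h1] using hmem
    · change D.act h v ∈ Submodule.span ℤ _
      rw [h1]
      exact neg_mem hmem
  · refine Submodule.span_le.2 ?_
    rintro _ ⟨x, rfl⟩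
    exact Submodule.subset_span ⟨_, rfl⟩

/-- The `ℤ`-basis of the lattice that consists of the vectors `orbitVec v x`. -/
def latticeBasis (hv0 : v ≠ 0) (hv : D.coact v = Finsupp.single g v)
    (hsign : ∀ c ∈ Subgroup.centralizer ({g} : Set G), D.act c v = v ∨ D.act c v = -v) :
    Module.Basis (conjugatesOf g) ℤ (D.lattice v) :=
  (Module.Basis.span ((LinearIndependent.iff_fractionRing ℤ ℚ).2
    (linearIndependent_orbitVec hv0 hv))).map
      (LinearEquiv.ofEq _ _ (span_int_orbitVec hsign).symm)

theorem coe_latticeBasis (hv0 : v ≠ 0) (hv : D.coact v = Finsupp.single g v)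
    (hsign : ∀ c ∈ Subgroup.centralizer ({g} : Set G), D.act c v = v ∨ D.act c v = -v)
    (x : conjugatesOf g) :
    (latticeBasis hv0 hv hsign x : V) = D.orbitVec v x := by
  rw [latticeBasis, Module.Basis.map_apply, LinearEquiv.coe_ofEq_apply, Module.Basis.span_apply]

theorem isMonomial_integralForm (hv0 : v ≠ 0) (hv : D.coact v = Finsupp.single g v)
    (hsign : ∀ c ∈ Subgroup.centralizer ({g} : Set G), D.act c v = v ∨ D.act c v = -v) :
    (D.integralForm hv).IsMonomial (latticeBasis hv0 hv hsign) (orbitData D g v) where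
  coact_basis x := by
    ext y
    change D.coact (latticeBasis hv0 hv hsign x : V) y = _
    rw [coe_latticeBasis, coact_orbitVec hv]
    by_cases hy : y = x
    · subst hy
      simp [orbitData, coe_latticeBasis]
    · simp [orbitData, Finsupp.single_eq_of_ne hy]
  act_basis h x := by
    ext
    change D.act h (latticeBasis hv0 hv hsign x : V) = _
    rw [coe_latticeBasis, act_orbitVec hsign, Submodule.coe_smul, coe_latticeBasis]

theorem span_rat_orbitVec
    (hsign : ∀ c ∈ Subgroup.centralizer ({g} : Set G), D.act c v = v ∨ D.act c v = -v)
    (hspan : Submodule.span ℚ (Set.range fun h => D.act h v) = ⊤) :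
    ⊤ ≤ Submodule.span ℚ (Set.range (D.orbitVec v : conjugatesOf g → V)) := by
  rw [← hspan, Submodule.span_le]
  rintro _ ⟨h, rfl⟩
  have h1 : D.act h v ∈ D.lattice v := Submodule.subset_span ⟨h, rfl⟩
  rw [span_int_orbitVec hsign] at h1
  exact Submodule.span_subset_span ℤ ℚ _ h1

/-- The basis of `V` that consists of the vectors `orbitVec v x`. -/
def orbitBasis (hv0 : v ≠ 0) (hv : D.coact v = Finsupp.single g v)
    (hsign : ∀ c ∈ Subgroup.centralizer ({g} : Set G), D.act c v = v ∨ D.act c v = -v)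
    (hspan : Submodule.span ℚ (Set.range fun h => D.act h v) = ⊤) :
    Module.Basis (conjugatesOf g) ℚ V :=
  Module.Basis.mk (linearIndependent_orbitVec hv0 hv) (span_rat_orbitVec hsign hspan)

theorem isMonomial_orbitBasis (hv0 : v ≠ 0) (hv : D.coact v = Finsupp.single g v)
    (hsign : ∀ c ∈ Subgroup.centralizer ({g} : Set G), D.act c v = v ∨ D.act c v = -v)
    (hspan : Submodule.span ℚ (Set.range fun h => D.act h v) = ⊤) :
    D.IsMonomial (orbitBasis hv0 hv hsign hspan) (orbitData D g v) where
  coact_basis x := by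
    rw [orbitBasis, Module.Basis.mk_apply, coact_orbitVec hv]
    rfl
  act_basis h x := by
    rw [orbitBasis, Module.Basis.mk_apply, Module.Basis.mk_apply, act_orbitVec hsign]

end Orbit

/-! ### The induced module -/

section InducedModule

variable {k G W : Type*} [CommRing k] [Group G] [AddCommGroup W] [Module k W] {g : G}
variable (ρ : Representation k (Subgroup.centralizer ({g} : Set G)) W)

theorem M_act_mk (h l : G) (w : W) :
    (M g ρ).act h (Representation.IndV.mk _ ρ l w) = Representation.IndV.mk _ ρ (l * h⁻¹) w :=
  Representation.ind_mk (Subgroup.centralizer ({g} : Set G)).subtype ρ h l w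

theorem IndV_mk_centralizer (c : Subgroup.centralizer ({g} : Set G)) (w : W) :
    Representation.IndV.mk (Subgroup.centralizer ({g} : Set G)).subtype ρ (c : G) (ρ c w) =
      Representation.IndV.mk _ ρ 1 w := by
  have h2 := Representation.Coinvariants.mk_self_apply
    (Representation.tprod ((Representation.leftRegular k G).comp
      (Subgroup.centralizer ({g} : Set G)).subtype) ρ) c (MonoidAlgebra.single 1 1 ⊗ₜ w)
  simpa using h2

/-- The component of degree `g` of `M(g, ρ)` is the image of `ρ`. -/
theorem exists_eq_mk_of_coact_eq_single {v : MCarrier g ρ}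
    (hv : (M g ρ).coact v = Finsupp.single g v) : ∃ w, v = Representation.IndV.mk _ ρ 1 w := by
  let N := LinearMap.range
    (Representation.IndV.mk (Subgroup.centralizer ({g} : Set G)).subtype ρ 1)
  have key : N.mkQ ∘ₗ Finsupp.lapply g ∘ₗ mCoact g ρ = 0 :=
    Representation.IndV.hom_ext _ _ fun h => by
      refine LinearMap.ext fun w => ?_
      have h1 := mCoact_mk g ρ h w
      simp only [LinearMap.comp_apply] at h1 ⊢
      rw [h1]
      by_cases hh : h⁻¹ * g * h = g
      · have hc : h ∈ Subgroup.centralizer ({g} : Set G) := by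
          rw [Subgroup.mem_centralizer_singleton_iff]
          calc h * g = h * (h⁻¹ * g * h) := by rw [hh]
            _ = g * h := by group
        have h2 := IndV_mk_centralizer ρ ⟨h, hc⟩ (ρ ⟨h, hc⟩⁻¹ w)
        rw [← Module.End.mul_apply, ← map_mul, mul_inv_cancel, map_one,
          Module.End.one_apply] at h2
        rw [hh, Finsupp.lapply_apply, Finsupp.single_eq_same,
          LinearMap.zero_apply, Submodule.mkQ_apply, Submodule.Quotient.mk_eq_zero]
        exact ⟨_, h2.symm⟩
      · rw [Finsupp.lapply_apply, Finsupp.single_eq_of_ne (Ne.symm hh), map_zero]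
        simp
  have h1 := LinearMap.congr_fun key v
  have h2 : mCoact g ρ v = Finsupp.single g v := hv
  rw [LinearMap.comp_apply, LinearMap.comp_apply, h2, Finsupp.lapply_apply,
    Finsupp.single_eq_same, LinearMap.zero_apply, Submodule.mkQ_apply,
    Submodule.Quotient.mk_eq_zero] at h1
  obtain ⟨w, hw⟩ := h1
  exact ⟨w, hw.symm⟩

theorem M_act_eq_or_neg (hρ : ∀ h, ρ h = 1 ∨ ρ h = -1) {v : MCarrier g ρ}
    (hv : (M g ρ).coact v = Finsupp.single g v) (c : G)
    (hc : c ∈ Subgroup.centralizer ({g} : Set G)) :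
    (M g ρ).act c v = v ∨ (M g ρ).act c v = -v := by
  obtain ⟨w, rfl⟩ := exists_eq_mk_of_coact_eq_single ρ hv
  have h1 := IndV_mk_centralizer ρ (⟨c, hc⟩⁻¹) (ρ ⟨c, hc⟩ w)
  rw [← Module.End.mul_apply, ← map_mul, inv_mul_cancel, map_one, Module.End.one_apply] at h1
  rw [M_act_mk, one_mul]
  change Representation.IndV.mk _ ρ c⁻¹ w = _ at h1
  rw [h1]
  rcases hρ ⟨c, hc⟩ with h2 | h2
  · exact Or.inl (by rw [h2, Module.End.one_apply])
  · exact Or.inr (by rw [h2, LinearMap.neg_apply, Module.End.one_apply, map_neg])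

theorem M_span_act_eq_top {k W : Type*} [Field k] [AddCommGroup W] [Module k W]
    (ρ : Representation k (Subgroup.centralizer ({g} : Set G)) W)
    (hW : Module.finrank k W = 1) {v : MCarrier g ρ} (hv0 : v ≠ 0)
    (hv : (M g ρ).coact v = Finsupp.single g v) :
    Submodule.span k (Set.range fun h => (M g ρ).act h v) = ⊤ := by
  obtain ⟨w, rfl⟩ := exists_eq_mk_of_coact_eq_single ρ hv
  have hw : w ≠ 0 := fun h => hv0 (by rw [h, map_zero])
  set N := Submodule.span k (Set.range fun h =>
    (M g ρ).act h (Representation.IndV.mk (Subgroup.centralizer ({g} : Set G)).subtype ρ 1 w))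
    with hN
  have key : N.mkQ = 0 := Representation.IndV.hom_ext _ _ fun h => by
    refine LinearMap.ext fun w' => ?_
    obtain ⟨a, rfl⟩ := (finrank_eq_one_iff_of_nonzero' w hw).1 hW w'
    rw [LinearMap.comp_apply, map_smul, map_smul, LinearMap.zero_comp, LinearMap.zero_apply]
    refine smul_eq_zero_of_right _ ((Submodule.Quotient.mk_eq_zero N).2 ?_)
    refine Submodule.subset_span ⟨h⁻¹, ?_⟩
    change (M g ρ).act h⁻¹ _ = _
    rw [M_act_mk, inv_inv, one_mul]
  rw [← N.ker_mkQ, key, LinearMap.ker_zero]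

end InducedModule

end YetterDrinfeld

end

theorem theorem4p3 {G : Type*} [Group G] (g : G) (hX : (conjugatesOf g).Finite)
    {W : Type*} [AddCommGroup W] [Module ℚ W]
    (ρ : Representation ℚ (Subgroup.centralizer ({g} : Set G)) W)
    (hW : Module.finrank ℚ W = 1)
    (hρ : ∀ h, ρ h = 1 ∨ ρ h = -1)
    (v : YetterDrinfeld.MCarrier g ρ) (hv0 : v ≠ 0)
    (hv : (YetterDrinfeld.M g ρ).coact v = Finsupp.single g v)
    (p : ℕ) (hp : p.Prime) :
    (∀ n : ℕ, Module.finrank (ZMod p) (((YetterDrinfeld.M g ρ).tau p hv).nicholsPart n) ≤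
      Module.finrank ℚ ((YetterDrinfeld.M g ρ).nicholsPart n)) ∧
    (∀ m : ℕ, Module.finrank ℚ ((YetterDrinfeld.M g ρ).nicholsPart m) = 1 →
      (∀ n : ℕ, m < n → Module.finrank ℚ ((YetterDrinfeld.M g ρ).nicholsPart n) = 0) →
      1 ≤ Module.finrank (ZMod p) (((YetterDrinfeld.M g ρ).tau p hv).nicholsPart m) →
      ∀ n : ℕ, Module.finrank (ZMod p) (((YetterDrinfeld.M g ρ).tau p hv).nicholsPart n) =
        Module.finrank ℚ ((YetterDrinfeld.M g ρ).nicholsPart n)) := by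
  classical
  have : Fact p.Prime := ⟨hp⟩
  have : Fintype (conjugatesOf g) := hX.fintype
  have hsign := YetterDrinfeld.M_act_eq_or_neg ρ hρ hv
  have hQ := YetterDrinfeld.isMonomial_orbitBasis hv0 hv hsign
    (YetterDrinfeld.M_span_act_eq_top ρ hW hv0 hv)
  have hZ := YetterDrinfeld.isMonomial_integralForm hv0 hv hsign
  have hF := hZ.modP p
  have hrankQ : ∀ n, Module.finrank ℚ ((YetterDrinfeld.M g ρ).nicholsPart n) =
      Module.finrank ℤ (LinearMap.range (((YetterDrinfeld.M g ρ).integralForm hv).derMatrix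
        (YetterDrinfeld.latticeBasis hv0 hv hsign) n).mulVecLin) := fun n => by
    rw [hQ.finrank_nicholsPart, YetterDrinfeld.derMatrix_eq_map_intCast hZ hQ,
      Matrix.rank_map_ratCast]
  have hrankF : ∀ n, Module.finrank (ZMod p) (((YetterDrinfeld.M g ρ).tau p hv).nicholsPart n) =
      ((((YetterDrinfeld.M g ρ).integralForm hv).modP p).derMatrix
        (YetterDrinfeld.ModP.basis p (YetterDrinfeld.latticeBasis hv0 hv hsign)) n).rank :=
    fun n => hF.finrank_nicholsPart n
  -- reduction modulo `p` cannot increase the rank of an integer matrix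
  have hle : ∀ n, Module.finrank (ZMod p) (((YetterDrinfeld.M g ρ).tau p hv).nicholsPart n) ≤
      Module.finrank ℚ ((YetterDrinfeld.M g ρ).nicholsPart n) := fun n => by
    rw [hrankQ, hrankF, YetterDrinfeld.derMatrix_eq_map_intCast hZ hF]
    exact Matrix.rank_map_zmodCast_le p _
  refine ⟨hle, fun m h1 h0 hm n => le_antisymm (hle n) ?_⟩
  rw [hrankQ] at h1
  rw [hrankF] at hm
  have hzero := h0 (m + 1) (Nat.lt_succ_self m)
  rw [hrankQ, Submodule.finrank_eq_zero, LinearMap.range_eq_bot, ← Matrix.mulVecLin_zero] at hzero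
  rw [hrankQ, hrankF]
  refine YetterDrinfeld.finrank_range_derMatrix_le hZ hF h1
    (Matrix.ext_of_mulVec_single fun i => LinearMap.congr_fun hzero _) (fun h => ?_) n
  rw [h, Matrix.rank_zero] at hm
  exact absurd hm (by norm_num)
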